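/- Let $n\ge 1$, $0<\xi_1<\dots<\xi_n=1$, $g_1,\dots,g_n>0$, and $g=\sum_{i=1}^n g_i\delta_{\xi_i}$. For $z\in\mathbb C$ consider the equation $$-\phi_{\xi\xi\xi}=z\,g\,\phi$$ in the sense of distributions on $(0,\infty)$, for continuous $\phi:[0,\infty)\to\mathbb C$ (the string is continued without mass to the right of $1$; derivatives are right-hand derivatives, so that $\phi_{\xi\xi}(1)$ means $\phi_{\xi\xi}(1+0)$). For $a=0,1,2$, a number $z\in\mathbb C$ belongs to the spectrum of type $a$ if there is a solution $\phi$, not identically zero on $[0,1]$, with $$\phi(0)=\phi_\xi(0)=0\quad\text{and}\quad \phi(1)=0\ (a=0),\qquad \phi_\xi(1)=0\ (a=1),\qquad \phi_{\xi\xi}(1)=0\ (a=2).$$ Put $(f,h)_g=\int_{[0,1]}f h\,dg=\sum_{i=1}^n g_i f(\xi_i)h(\xi_i)$. Then the following hold. For every $z\in\mathbb C$ there is a unique solution $\phi(\cdot;z)$ with $\phi(0)=\phi_\xi(0)=0$, $\phi_{\xi\xi}(0)=1$, and the spectra of types $0,1,2$ are the zero sets of $z\mapsto\phi(1;z)$,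 $\phi_\xi(1;z)$, $\phi_{\xi\xi}(1;z)$ respectively. 1. All three spectra consist of positive real numbers and are simple: each eigenfunction is unique on $[0,1]$ up to a scalar factor, and each eigenvalue is a simple zero of the corresponding function $\phi(1;z)$, $\phi_\xi(1;z)$ or $\phi_{\xi\xi}(1;z)$. The spectra of types $0$ and $1$ have exactly $n-1$ points each, and the spectrum of type $2$ has exactly $n$ points. 2. If $z_{a,1}<z_{a,2}<\cdots$ denote the points of the spectrum of type $a$, then $$0<z_{2,1}<z_{1,1}<z_{0,1}<\dots<z_{2,n-1}<z_{1,n-1}<z_{0,n-1}<z_{2,n}.$$ 3. The eigenfunctions $\phi_{2,j}(\xi)=\phi(\xi;z_{2,j})$, $j=1,\dots,n$, satisfy $$(\phi_{2,i},\phi_{2,j})_g=\frac{\phi_{2,i,\xi}(1)\,\phi_{2,j,\xi}(1)}{z_{2,i}+z_{2,j}},\qquad 1\le i,j\le n,$$ and they are linearly independent in $L^2([0,1],g)$. -/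

import Mathlib

open scoped ContDiff

noncomputable section

namespace CubicString

/-- The discrete mass distribution `g = ∑ i, m i • δ_{ξ i}`, as a measure on the line. -/
def massMeasure {n : ℕ} (m ξ : Fin n → ℝ) : MeasureTheory.Measure ℝ :=
  ∑ i, ENNReal.ofReal (m i) • MeasureTheory.Measure.dirac (ξ i)

/-- The right-hand derivative. For the functions below (which are piecewise quadratic on `[0, ∞)`
with a continuous derivative) `rightDeriv φ` is `φ_ξ`, and `rightDeriv (rightDeriv φ)` is `φ_ξξ`,
taken as a right-hand limit at the point masses. -/
def rightDeriv (φ : ℝ → ℂ) (x : ℝ) : ℂ := derivWithin φ (Set.Ioi x) x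

/-- `-φ_ξξξ = z g φ` in the sense of distributions on `(0, ∞)`, for `φ` continuous on `[0, ∞)`.
The measure `g` has all its mass in `(0, 1]`; to the right of `1` the string is continued without
mass, so that right-hand limits at `1` are available even if `g` has a point mass there. Only the
values of `φ` on `[0, ∞)` matter. -/
structure IsSolution (g : MeasureTheory.Measure ℝ) (z : ℂ) (φ : ℝ → ℂ) : Prop where
  continuousOn : ContinuousOn φ (Set.Ici 0)
  weak_eq : ∀ η : ℝ → ℝ, ContDiff ℝ ∞ η → HasCompactSupport η → tsupport η ⊆ Set.Ioi 0 →
    ∫ x, ((iteratedDeriv 3 η x : ℝ) : ℂ) * φ x = z * ∫ x, (η x : ℂ) * φ x ∂g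

/-- The solution of the initial value problem `φ(0) = φ_ξ(0) = 0`, `φ_ξξ(0) = 1`. -/
structure IsIVPSolution (g : MeasureTheory.Measure ℝ) (z : ℂ) (φ : ℝ → ℂ) : Prop extends
    IsSolution g z φ where
  zero : φ 0 = 0
  deriv_zero : rightDeriv φ 0 = 0
  deriv2_zero : rightDeriv (rightDeriv φ) 0 = 1

/-- The quantity that vanishes in the boundary condition at `1`: `φ(1)` for type 0,
`φ_ξ(1)` for type 1, `φ_ξξ(1)` (a right-hand limit) for type 2. -/
def endValue (a : Fin 3) (φ : ℝ → ℂ) : ℂ :=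
  match a with
  | 0 => φ 1
  | 1 => rightDeriv φ 1
  | 2 => rightDeriv (rightDeriv φ) 1

/-- `φ` is an eigenfunction, with eigenvalue `z`, of the boundary value problem of type `a`. -/
structure IsEigenfunction (g : MeasureTheory.Measure ℝ) (a : Fin 3) (z : ℂ) (φ : ℝ → ℂ) : Prop
    extends IsSolution g z φ where
  zero : φ 0 = 0
  deriv_zero : rightDeriv φ 0 = 0
  endValue_eq : endValue a φ = 0
  ne_zero : ∃ x ∈ Set.Icc (0 : ℝ) 1, φ x ≠ 0

/-- The spectrum (all complex eigenvalues) of the boundary value problem of type `a`. -/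
def eigenvalues (g : MeasureTheory.Measure ℝ) (a : Fin 3) : Set ℂ :=
  {z | ∃ φ, IsEigenfunction g a z φ}

/-- The bilinear form `(f, h)_g`, the integral of `f h` over `[0, 1]` against `g`. -/
def form (g : MeasureTheory.Measure ℝ) (f h : ℝ → ℂ) : ℂ :=
  ∫ x in Set.Icc (0 : ℝ) 1, f x * h x ∂g

end CubicString

end

/-!
A weak solution with `φ(0) = φ'(0) = 0` and `φ''(0) = 1` is the quadratic spline
`φ(x) = x² / 2 - z ∑ mᵢ φ(ξᵢ) (x - ξᵢ)₊² / 2`, whose values are computed from left to right; in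
particular `φ(x; z)`, `φ'(x; z)` and `φ''(x; z)` are polynomials in `z`. Their roots are followed
from left to right. A massless interval of length `l` replaces `(φ, φ', φ'')` by
`(φ + l φ' + l² φ'' / 2, φ' + l φ'', φ'')`, and a point mass `m` replaces `φ''` by `φ'' - m z φ`.
Each of these operations adds two polynomials with alternating roots, and counting the sign changes
of the sum shows that the pattern `0 < a₀ < b₀ < c₀ < a₁ < b₁ < ⋯` of the roots of `φ''`, `φ'` and
`φ` survives.

The bracket `u' v' - u v'' - u'' v` of two solutions with parameters `z` and `w` is constant between
the masses and increases by `(z + w) mᵢ u(ξᵢ) v(ξᵢ)` at `ξᵢ`; at `1` it equals `u'(1) v'(1)` if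
`u''(1) = v''(1) = 0`, which is the formula for the form. Under this end condition the values at the
masses form an eigenvector, with eigenvalue `z⁻¹`, of the matrix of the Green operator of the
boundary problem, so the eigenfunctions of type 2 are linearly independent.
-/

namespace CubicString

section Interlacing

open Polynomial

/-- `f` has exactly the `n` real roots `a 0, …, a (n - 1)`, counted with multiplicity, no other
complex ones, and is positive near `-∞`. The values `a i` with `n ≤ i` are irrelevant. -/
def HasRoots (f : ℝ[X]) (a : ℕ → ℝ) (n : ℕ) : Prop :=
  ∃ A : ℝ, 0 < A ∧ f = C A * ∏ i ∈ Finset.range n, (C (a i) - X)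

theorem natDegree_prod_C_sub_X_le (a : ℕ → ℝ) (n : ℕ) :
    (∏ i ∈ Finset.range n, (C (a i) - X)).natDegree ≤ n := by
  refine (natDegree_prod_le _ _).trans ((Finset.sum_le_card_nsmul _ _ 1 fun i _ => ?_).trans ?_)
  · exact (natDegree_sub_le _ _).trans (by simp)
  · simp

theorem coeff_prod_C_sub_X (a : ℕ → ℝ) (n : ℕ) :
    (∏ i ∈ Finset.range n, (C (a i) - X)).coeff n = (-1) ^ n := by
  simpa using coeff_prod_of_natDegree_le (s := Finset.range n) (f := fun i => C (a i) - X) 1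
    fun i _ => (natDegree_sub_le _ _).trans (by simp)

theorem aeval_C_mul_prod (A : ℝ) (a : ℕ → ℝ) (n : ℕ) (z : ℂ) :
    aeval z (C A * ∏ i ∈ Finset.range n, (C (a i) - X)) =
      A * ∏ i ∈ Finset.range n, ((a i : ℂ) - z) := by
  simp [map_prod]

namespace HasRoots

variable {f : ℝ[X]} {a : ℕ → ℝ} {n : ℕ}

theorem C_mul (h : HasRoots f a n) {c : ℝ} (hc : 0 < c) : HasRoots (C c * f) a n := by
  obtain ⟨A, hA, rfl⟩ := h
  exact ⟨c * A, mul_pos hc hA, by rw [C_mul, mul_assoc]⟩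

theorem neg_X_mul (h : HasRoots f (fun i => a (i + 1)) n) (h0 : a 0 = 0) :
    HasRoots (-(X * f)) a (n + 1) := by
  obtain ⟨A, hA, rfl⟩ := h
  refine ⟨A, hA, ?_⟩
  rw [Finset.prod_range_succ', h0, C_0]
  ring

theorem eval_eq_zero (h : HasRoots f a n) {i : ℕ} (hi : i < n) : f.eval (a i) = 0 := by
  obtain ⟨A, -, rfl⟩ := h
  rw [eval_C_mul, eval_prod, Finset.prod_eq_zero (Finset.mem_range.2 hi) (by simp), mul_zero]

theorem natDegree_le (h : HasRoots f a n) : f.natDegree ≤ n := by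
  obtain ⟨A, -, rfl⟩ := h
  exact (natDegree_C_mul_le _ _).trans (natDegree_prod_C_sub_X_le a n)

theorem coeff_pos (h : HasRoots f a n) : 0 < (-1) ^ n * f.coeff n := by
  obtain ⟨A, hA, rfl⟩ := h
  rwa [coeff_C_mul, coeff_prod_C_sub_X, mul_left_comm, ← mul_pow, neg_one_mul, neg_neg, one_pow,
    mul_one]

theorem eval_sign (h : HasRoots f a n) {k : ℕ} (hk : k ≤ n) {x : ℝ} (hlt : ∀ i < k, a i < x)
    (hgt : ∀ i, k ≤ i → i < n → x < a i) : 0 < (-1) ^ k * f.eval x := by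
  obtain ⟨A, hA, rfl⟩ := h
  obtain ⟨d, rfl⟩ := Nat.exists_eq_add_of_le hk
  have hflip : ∏ i ∈ Finset.range k, (x - a i) =
      (-1) ^ k * ∏ i ∈ Finset.range k, (a i - x) := by
    simpa using Finset.prod_neg (s := Finset.range k) fun i => a i - x
  have hbelow : 0 < ∏ i ∈ Finset.range k, (x - a i) :=
    Finset.prod_pos fun i hi => sub_pos.2 (hlt i (Finset.mem_range.1 hi))
  have habove : 0 < ∏ i ∈ Finset.range d, (a (k + i) - x) := Finset.prod_pos fun i hi =>
    sub_pos.2 (hgt _ (by omega) (Nat.add_lt_add_left (Finset.mem_range.1 hi) k))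
  rw [eval_C_mul, eval_prod, Finset.prod_range_add]
  simp only [eval_sub, eval_C, eval_X]
  rw [mul_left_comm, ← mul_assoc ((-1) ^ k), ← hflip]
  positivity

theorem of_eval_eq_zero (hdeg : f.natDegree ≤ n) (hcoeff : 0 < (-1) ^ n * f.coeff n)
    (hinj : Set.InjOn a (Finset.range n)) (hroot : ∀ i < n, f.eval (a i) = 0) :
    HasRoots f a n := by
  have hprod : HasRoots (C ((-1) ^ n * f.coeff n) * ∏ i ∈ Finset.range n, (C (a i) - X)) a n :=
    ⟨_, hcoeff, rfl⟩
  refine ⟨_, hcoeff, eq_of_degree_sub_lt_of_eval_index_eq (Finset.range n) hinj ?_ fun i hi => ?_⟩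
  · rw [Finset.card_range, degree_lt_iff_coeff_zero]
    intro k hk
    rw [coeff_sub]
    rcases hk.eq_or_lt with rfl | hk
    · rw [coeff_C_mul, coeff_prod_C_sub_X, mul_right_comm, ← mul_pow, neg_one_mul, neg_neg,
        one_pow, one_mul, sub_self]
    · rw [coeff_eq_zero_of_natDegree_lt (hdeg.trans_lt hk),
        coeff_eq_zero_of_natDegree_lt (hprod.natDegree_le.trans_lt hk), sub_self]
  · rw [hroot i (Finset.mem_range.1 hi), hprod.eval_eq_zero (Finset.mem_range.1 hi)]

theorem aeval_eq_zero_iff (h : HasRoots f a n) {z : ℂ} : aeval z f = 0 ↔ ∃ i < n, z = a i := by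
  obtain ⟨A, hA, rfl⟩ := h
  have hA' : (A : ℂ) ≠ 0 := Complex.ofReal_ne_zero.2 hA.ne'
  rw [aeval_C_mul_prod, mul_eq_zero_iff_left hA', Finset.prod_eq_zero_iff]
  simp only [Finset.mem_range, sub_eq_zero, eq_comm]

theorem analyticOrderAt_aeval (h : HasRoots f a n) (hinj : Set.InjOn a (Finset.range n)) {i : ℕ}
    (hi : i < n) : analyticOrderAt (fun z : ℂ => aeval z f) (a i) = 1 := by
  obtain ⟨A, hA, rfl⟩ := h
  have hi := Finset.mem_range.2 hi
  have han : AnalyticAt ℂ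
      (fun z : ℂ => aeval z (C A * ∏ i ∈ Finset.range n, (C (a i) - X))) (a i) := by
    simp only [aeval_C_mul_prod]
    fun_prop
  rw [← Nat.cast_one, han.analyticOrderAt_eq_natCast]
  refine ⟨fun z => -(A * ∏ j ∈ (Finset.range n).erase i, ((a j : ℂ) - z)), by fun_prop, ?_,
    .of_forall fun z => ?_⟩
  · refine neg_ne_zero.2 (mul_ne_zero (Complex.ofReal_ne_zero.2 hA.ne')
      (Finset.prod_ne_zero_iff.2 fun j hj => ?_))
    obtain ⟨hji, hj⟩ := Finset.mem_erase.1 hj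
    exact sub_ne_zero.2 (Complex.ofReal_injective.ne (hinj.ne hj hi hji))
  · beta_reduce
    rw [aeval_C_mul_prod, ← Finset.mul_prod_erase _ _ hi, smul_eq_mul, pow_one]
    ring

end HasRoots

theorem exists_sign_gt {f : ℝ[X]} {n : ℕ} (hn : n ≠ 0) (hdeg : f.natDegree ≤ n)
    (hcoeff : 0 < (-1) ^ n * f.coeff n) (x : ℝ) : ∃ y, x < y ∧ 0 < (-1) ^ n * f.eval y := by
  have hdeg : f.natDegree = n :=
    hdeg.antisymm (le_natDegree_of_ne_zero fun h => by simp [h] at hcoeff)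
  have hlim := tendsto_atTop_of_leadingCoeff_nonneg (C ((-1 : ℝ) ^ n) * f)
    (by
      rw [degree_C_mul (by simp)]
      exact natDegree_pos_iff_degree_pos.1 (by omega))
    (by
      rw [leadingCoeff_mul, leadingCoeff_C, leadingCoeff, hdeg]
      exact hcoeff.le)
  obtain ⟨y, hpos, hxy⟩ := ((hlim.eventually_gt_atTop 0).and (Filter.eventually_gt_atTop x)).exists
  exact ⟨y, hxy, by simpa using hpos⟩

theorem exists_root_between {f : ℝ[X]} {k : ℕ} {x y : ℝ} (hxy : x < y)
    (hx : 0 < (-1) ^ k * f.eval x) (hy : 0 < (-1) ^ (k + 1) * f.eval y) :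
    ∃ t, x < t ∧ t < y ∧ f.eval t = 0 := by
  have hcont : ContinuousOn (fun t => (-1) ^ k * f.eval t) (Set.Icc x y) := by fun_prop
  obtain ⟨t, ht, hroot⟩ := intermediate_value_Ioo' hxy.le hcont
    (show (0 : ℝ) ∈ Set.Ioo _ _ from ⟨by rw [pow_succ] at hy; linarith, hx⟩)
  exact ⟨t, ht.1, ht.2, by simpa using hroot⟩

/-- The points `a i` (`i < N`) and `b i` (`i < n`) alternate, starting with an `a`:
`a 0 < b 0 < a 1 < b 1 < ⋯`. -/
structure Alternates (a : ℕ → ℝ) (N : ℕ) (b : ℕ → ℝ) (n : ℕ) : Prop where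
  le : n ≤ N
  le_succ : N ≤ n + 1
  lt : ∀ i < n, a i < b i
  lt_succ : ∀ i, i + 1 < N → b i < a (i + 1)

namespace Alternates

variable {a b : ℕ → ℝ} {N n : ℕ}

theorem strictMonoOn (h : Alternates a N b n) : StrictMonoOn a (Set.Iio N) :=
  strictMonoOn_of_lt_add_one Set.ordConnected_Iio fun i _ _ hi =>
    (h.lt i (by have := h.le_succ; simp only [Set.mem_Iio] at hi; omega)).trans (h.lt_succ i hi)

theorem lt_of_le (h : Alternates a N b n) {i j : ℕ} (hij : i ≤ j) (hj : j < n) : a i < b j :=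
  (h.strictMonoOn.monotoneOn (hij.trans_lt (hj.trans_le h.le)) (hj.trans_le h.le) hij).trans_lt
    (h.lt j hj)

theorem lt_of_lt (h : Alternates a N b n) {i j : ℕ} (hij : i < j) (hj : j < N) : b i < a j :=
  (h.lt_succ i (by omega)).trans_le
    (h.strictMonoOn.monotoneOn (show i + 1 < N by omega) hj hij)

end Alternates

theorem Alternates.exists_roots {f : ℝ[X]} {a b : ℕ → ℝ} {N n : ℕ} (h : Alternates a N b n)
    (hdeg : f.natDegree ≤ N) (hcoeff : 0 < (-1) ^ N * f.coeff N)
    (ha : ∀ k < N, 0 < (-1) ^ k * f.eval (a k))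
    (hb : ∀ k < n, 0 < (-1) ^ (k + 1) * f.eval (b k)) :
    ∃ c : ℕ → ℝ, ∀ k < N, a k < c k ∧ (k < n → c k < b k) ∧ f.eval (c k) = 0 := by
  have hroot : ∀ k, ∃ t, k < N → a k < t ∧ (k < n → t < b k) ∧ f.eval t = 0 := fun k => by
    by_cases hk : k < N
    · rcases lt_or_ge k n with hkn | hkn
      · obtain ⟨t, hat, htb, ht⟩ := exists_root_between (h.lt k hkn) (ha k hk) (hb k hkn)
        exact ⟨t, fun _ => ⟨hat, fun _ => htb, ht⟩⟩
      · obtain rfl : N = k + 1 := by have := h.le_succ; omega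
        obtain ⟨y, hy, hsign⟩ := exists_sign_gt k.succ_ne_zero hdeg hcoeff (a k)
        obtain ⟨t, hat, -, ht⟩ := exists_root_between hy (ha k hk) hsign
        exact ⟨t, fun _ => ⟨hat, fun hlt => absurd hlt hkn.not_gt, ht⟩⟩
    · exact ⟨0, fun hlt => absurd hlt hk⟩
  choose c hc using hroot
  exact ⟨c, hc⟩

theorem HasRoots.exists_add {f g : ℝ[X]} {a b : ℕ → ℝ} {N n : ℕ} (hf : HasRoots f b n)
    (hg : HasRoots g a N) (h : Alternates a N b n) :
    ∃ c, HasRoots (f + g) c N ∧ (∀ i < N, a i < c i) ∧ ∀ i < n, c i < b i := by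
  have hle := h.le
  have hle' := h.le_succ
  have hdeg : (f + g).natDegree ≤ N :=
    natDegree_add_le_of_degree_le (hf.natDegree_le.trans hle) hg.natDegree_le
  have hcoeff : 0 < (-1) ^ N * (f + g).coeff N := by
    rw [coeff_add, mul_add]
    refine add_pos_of_nonneg_of_pos ?_ hg.coeff_pos
    rcases hle.eq_or_lt with rfl | hlt
    · exact hf.coeff_pos.le
    · rw [coeff_eq_zero_of_natDegree_lt (hf.natDegree_le.trans_lt hlt), mul_zero]
  have hsign_a : ∀ k < N, 0 < (-1) ^ k * (f + g).eval (a k) := fun k hk => by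
    rw [eval_add, hg.eval_eq_zero hk, add_zero]
    exact hf.eval_sign (by omega) (fun i hi => h.lt_of_lt hi hk) fun i hi hin => h.lt_of_le hi hin
  have hsign_b : ∀ k < n, 0 < (-1) ^ (k + 1) * (f + g).eval (b k) := fun k hk => by
    rw [eval_add, hf.eval_eq_zero hk, zero_add]
    exact hg.eval_sign (by omega) (fun i hi => h.lt_of_le (by omega) hk)
      fun i hi hiN => h.lt_of_lt (by omega) hiN
  obtain ⟨c, hc⟩ := h.exists_roots hdeg hcoeff hsign_a hsign_b
  have hmono : StrictMonoOn c (Finset.range N) := fun i hi j hj hij => by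
    simp only [Finset.coe_range, Set.mem_Iio] at hi hj
    calc c i < b i := (hc i hi).2.1 (by omega)
      _ < a j := h.lt_of_lt hij hj
      _ < c j := (hc j hj).1
  exact ⟨c, .of_eval_eq_zero hdeg hcoeff hmono.injOn fun i hi => (hc i hi).2.2,
    fun i hi => (hc i hi).1, fun i hi => (hc i (by omega)).2.1 hi⟩

/-- The interlacing pattern `0 < a 0 < b 0 < c 0 < a 1 < b 1 < ⋯` of the roots of the values `p`
of a solution, `q` of its slope and `r` of its second derivative, as polynomials in the spectral
parameter: just to the left of a point mass `N = n`, just to the right of it `N = n + 1`. -/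
structure Interlaced (p q r : ℝ[X]) (a b c : ℕ → ℝ) (n N : ℕ) : Prop where
  value : HasRoots p c n
  slope : HasRoots q b n
  curvature : HasRoots r a N
  le : n ≤ N
  le_succ : N ≤ n + 1
  pos : ∀ i < N, 0 < a i
  lt_slope : ∀ i < n, a i < b i
  slope_lt : ∀ i < n, b i < c i
  lt_succ : ∀ i, i + 1 < N → c i < a (i + 1)

namespace Interlaced

variable {p q r : ℝ[X]} {a b c : ℕ → ℝ} {n N : ℕ}

theorem strictMonoOn_curvature (H : Interlaced p q r a b c n N) :
    StrictMonoOn a (Set.Iio N) :=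
  strictMonoOn_of_lt_add_one Set.ordConnected_Iio fun i _ _ hi => by
    have hin : i < n := by have := H.le_succ; simp only [Set.mem_Iio] at hi; omega
    exact (H.lt_slope i hin).trans ((H.slope_lt i hin).trans (H.lt_succ i hi))

theorem strictMonoOn_slope (H : Interlaced p q r a b c n N) : StrictMonoOn b (Set.Iio n) :=
  strictMonoOn_of_lt_add_one Set.ordConnected_Iio fun i _ hi hi' =>
    (H.slope_lt i hi).trans ((H.lt_succ i (hi'.trans_le H.le)).trans (H.lt_slope (i + 1) hi'))

theorem strictMonoOn_value (H : Interlaced p q r a b c n N) : StrictMonoOn c (Set.Iio n) :=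
  strictMonoOn_of_lt_add_one Set.ordConnected_Iio fun i _ _ hi' =>
    (H.lt_succ i (hi'.trans_le H.le)).trans
      ((H.lt_slope (i + 1) hi').trans (H.slope_lt (i + 1) hi'))

theorem pos_slope (H : Interlaced p q r a b c n N) {i : ℕ} (hi : i < n) : 0 < b i :=
  (H.pos i (hi.trans_le H.le)).trans (H.lt_slope i hi)

theorem pos_value (H : Interlaced p q r a b c n N) {i : ℕ} (hi : i < n) : 0 < c i :=
  (H.pos_slope hi).trans (H.slope_lt i hi)

theorem massless (H : Interlaced p q r a b c n (n + 1)) {l : ℝ} (hl : 0 < l) :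
    ∃ b' c', Interlaced (p + C l * q + C (l ^ 2 / 2) * r) (q + C l * r) r a b' c'
      (n + 1) (n + 1) := by
  have hhalf := H.curvature.C_mul (half_pos hl)
  obtain ⟨b₁, hb₁, hab₁, hb₁b⟩ := H.slope.exists_add hhalf
    ⟨by omega, le_rfl, H.lt_slope, fun i hi =>
      (H.slope_lt i (by omega)).trans (H.lt_succ i hi)⟩
  have hb₁c : ∀ i < n, b₁ i < c i := fun i hi => (hb₁b i hi).trans (H.slope_lt i hi)
  have hb₁a : ∀ i, i + 1 < n + 1 → b₁ i < a (i + 1) := fun i hi =>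
    (hb₁c i (by omega)).trans (H.lt_succ i hi)
  obtain ⟨b', hb', hab', hb'b₁⟩ := hb₁.exists_add hhalf ⟨le_rfl, by omega, hab₁, hb₁a⟩
  obtain ⟨c', hc', hb₁c', hc'c⟩ := H.value.exists_add (hb₁.C_mul hl)
    ⟨by omega, le_rfl, hb₁c, fun i hi =>
      (H.lt_succ i hi).trans (hab₁ _ hi)⟩
  refine ⟨b', c', ?_, ?_, H.curvature, le_rfl, by omega, H.pos, hab',
    fun i hi => (hb'b₁ i hi).trans (hb₁c' i hi),
    fun i hi => (hc'c i (by omega)).trans (H.lt_succ i hi)⟩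
  · convert hc' using 1
    rw [mul_add, ← mul_assoc, ← C_mul]
    ring_nf
  · convert hb' using 1
    rw [add_assoc, ← add_mul, ← C_add, add_halves]

theorem mass (H : Interlaced p q r a b c n n) {g : ℝ} (hg : 0 < g) :
    ∃ a', Interlaced p q (r - X * (C g * p)) a' b c n (n + 1) := by
  obtain ⟨c₀, hc₀, rfl⟩ : ∃ c₀ : ℕ → ℝ, c₀ 0 = 0 ∧ (fun i => c₀ (i + 1)) = c :=
    ⟨fun | 0 => 0 | i + 1 => c i, rfl, rfl⟩
  have halt : Alternates c₀ (n + 1) a n :=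
    ⟨by omega, le_rfl, fun i hi => by
      cases i with
      | zero => exact hc₀ ▸ H.pos 0 hi
      | succ i => exact H.lt_succ i hi,
    fun i hi => (H.lt_slope i (by omega)).trans (H.slope_lt i (by omega))⟩
  have hc₀_nonneg : ∀ i < n + 1, 0 ≤ c₀ i := fun i hi => by
    cases i with
    | zero => exact hc₀.ge
    | succ i => exact (H.pos_value (by omega)).le
  obtain ⟨a', ha', hc₀a', ha'a⟩ :=
    H.curvature.exists_add ((H.value.C_mul hg).neg_X_mul hc₀) halt
  exact ⟨a', H.value, H.slope, by rwa [sub_eq_add_neg], by omega, le_rfl,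
    fun i hi => (hc₀_nonneg i hi).trans_lt (hc₀a' i hi),
    fun i hi => (ha'a i hi).trans (H.lt_slope i hi), H.slope_lt,
    fun i hi => hc₀a' (i + 1) hi⟩

end Interlaced

end Interlacing

section TestFunctions

open MeasureTheory

/-- The space `𝓓(U)` of real test functions: smooth, with compact support contained in `U`. -/
structure IsTestOn (U : Set ℝ) (η : ℝ → ℝ) : Prop where
  smooth : ContDiff ℝ ∞ η
  compact : HasCompactSupport η
  tsupport_subset : tsupport η ⊆ U

namespace IsTestOn

variable {U : Set ℝ} {η θ : ℝ → ℝ}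

theorem contDiff (h : IsTestOn U η) (k : ℕ) : ContDiff ℝ k η :=
  h.smooth.of_le (by exact_mod_cast le_top)

theorem eq_zero (h : IsTestOn U η) {x : ℝ} (hx : x ∉ U) : η x = 0 :=
  image_eq_zero_of_notMem_tsupport fun hx' => hx (h.tsupport_subset hx')

protected theorem deriv (h : IsTestOn U η) : IsTestOn U (deriv η) :=
  ⟨(contDiff_infty_iff_deriv.1 h.smooth).2, h.compact.deriv,
    tsupport_deriv_subset.trans h.tsupport_subset⟩

theorem hasDerivAt (h : IsTestOn U η) (x : ℝ) : HasDerivAt η (deriv η x) x :=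
  (h.smooth.differentiable (by simp) x).hasDerivAt

protected theorem iteratedDeriv (h : IsTestOn U η) (k : ℕ) : IsTestOn U (iteratedDeriv k η) := by
  induction k with
  | zero => rwa [iteratedDeriv_zero]
  | succ k ih => rw [iteratedDeriv_succ]; exact ih.deriv

theorem hasDerivAt_iteratedDeriv (h : IsTestOn U η) (k : ℕ) (x : ℝ) :
    HasDerivAt (iteratedDeriv k η) (iteratedDeriv (k + 1) η x) x := by
  rw [iteratedDeriv_succ]
  exact (h.iteratedDeriv k).hasDerivAt x

protected theorem sub_smul (h : IsTestOn U η) (h' : IsTestOn U θ) (c : ℝ) :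
    IsTestOn U (η - c • θ) := by
  refine ⟨h.smooth.sub (h'.smooth.const_smul c), h.compact.sub h'.compact.smul_left, ?_⟩
  refine (closure_mono (Function.support_sub _ _)).trans ?_
  rw [closure_union]
  exact Set.union_subset h.tsupport_subset
    ((tsupport_smul_subset_right (fun _ => c) θ).trans h'.tsupport_subset)

theorem integrable_smul {E : Type*} [NormedAddCommGroup E] [NormedSpace ℝ E] (h : IsTestOn U η)
    (hU : IsOpen U) {ψ : ℝ → E} (hψ : ContinuousOn ψ U) : Integrable fun x => η x • ψ x := by
  have hcont : Continuous fun x => η x • ψ x :=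
    (h.smooth.continuous.continuousOn.smul hψ).continuous_of_tsupport_subset hU
      ((tsupport_smul_subset_left _ _).trans h.tsupport_subset)
  exact hcont.integrable_of_hasCompactSupport h.compact.smul_right

theorem integrable (h : IsTestOn U η) : Integrable η :=
  h.smooth.continuous.integrable_of_hasCompactSupport h.compact

theorem exists_tsupport_subset_Icc (h : IsTestOn U η) (hU : U.OrdConnected) :
    ∃ a b, tsupport η ⊆ Set.Icc a b ∧ Set.Icc a b ⊆ U := by
  rcases (tsupport η).eq_empty_or_nonempty with hempty | hne
  · exact ⟨1, 0, by simp [hempty], by simp⟩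
  · obtain ⟨a, ha, ha'⟩ := h.compact.isCompact.exists_isLeast hne
    obtain ⟨b, hb, hb'⟩ := h.compact.isCompact.exists_isGreatest hne
    exact ⟨a, b, fun x hx => ⟨ha' hx, hb' hx⟩,
      hU.out (h.tsupport_subset ha) (h.tsupport_subset hb)⟩

theorem exists_deriv_eq (h : IsTestOn U η) (hU : U.OrdConnected) (h0 : ∫ x, η x = 0) :
    ∃ θ, IsTestOn U θ ∧ deriv θ = η := by
  obtain ⟨a, b, hab, habU⟩ := h.exists_tsupport_subset_Icc hU
  have hη : ∀ t, t ∉ Set.Icc a b → η t = 0 := fun t ht =>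
    image_eq_zero_of_notMem_tsupport fun ht' => ht (hab ht')
  set θ : ℝ → ℝ := fun x => ∫ t in (a - 1)..x, η t
  have hderiv : ∀ x, HasDerivAt θ (η x) x := fun x =>
    intervalIntegral.integral_hasDerivAt_right (h.smooth.continuous.intervalIntegrable _ _)
      (h.smooth.continuous.stronglyMeasurableAtFilter _ _) h.smooth.continuous.continuousAt
  have hderiv_eq : deriv θ = η := funext fun x => (hderiv x).deriv
  have hzero : ∀ x, x ∉ Set.Icc a b → θ x = 0 := fun x hx => by
    rcases lt_or_ge x a with hxa | hxa
    · refine intervalIntegral.integral_zero_ae (.of_forall fun t ht => hη t fun ht' => ?_)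
      exact (ht.2.trans_lt (max_lt (sub_one_lt a) hxa)).not_ge ht'.1
    · rw [← h0]
      refine (intervalIntegral.integral_of_le (by linarith)).trans
        (setIntegral_eq_integral_of_forall_compl_eq_zero fun t ht => hη t fun ht' => ht ⟨?_, ?_⟩)
      · linarith [ht'.1]
      · exact (ht'.2.trans_lt (not_le.1 fun hxb => hx ⟨hxa, hxb⟩)).le
  have hsupp : tsupport θ ⊆ Set.Icc a b :=
    closure_minimal (fun x hx => by_contra fun hx' => hx (hzero x hx')) isClosed_Icc
  refine ⟨θ, ⟨?_, ?_, hsupp.trans habU⟩, hderiv_eq⟩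
  · rw [contDiff_infty_iff_deriv, hderiv_eq]
    exact ⟨fun x => (hderiv x).differentiableAt, h.smooth⟩
  · exact .of_support_subset_isCompact isCompact_Icc ((subset_tsupport _).trans hsupp)

theorem integral_iteratedDeriv_mul_pow (h : IsTestOn U η) (k : ℕ) :
    ∫ x, iteratedDeriv k η x * x ^ k = (-1) ^ k * k.factorial * ∫ x, η x := by
  induction k with
  | zero => simp
  | succ k ih =>
    have hk := h.iteratedDeriv k
    have hint : ∀ {θ : ℝ → ℝ}, IsTestOn U θ → ∀ {u : ℝ → ℝ}, Continuous u →
        Integrable (u * θ) := fun hθ _ hu =>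
      (hu.mul hθ.smooth.continuous).integrable_of_hasCompactSupport hθ.compact.mul_left
    have hpow : ∀ x : ℝ, HasDerivAt (fun x : ℝ => x ^ (k + 1)) ((k + 1 : ℕ) * x ^ k) x :=
      fun x => by simpa using hasDerivAt_pow (k + 1) x
    calc ∫ x, iteratedDeriv (k + 1) η x * x ^ (k + 1)
        = ∫ x, x ^ (k + 1) * iteratedDeriv (k + 1) η x := by
          simp only [mul_comm]
      _ = -∫ x, (k + 1 : ℕ) * x ^ k * iteratedDeriv k η x :=
          integral_mul_deriv_eq_deriv_mul_of_integrable (fun x _ => hpow x)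
            (fun x _ => h.hasDerivAt_iteratedDeriv k x)
            (hint (h.iteratedDeriv (k + 1)) (by fun_prop)) (hint hk (by fun_prop))
            (hint hk (by fun_prop))
      _ = -((k + 1 : ℕ) * ∫ x, iteratedDeriv k η x * x ^ k) := by
          rw [← integral_const_mul]
          simp only [mul_assoc, mul_comm]
      _ = (-1) ^ (k + 1) * (k + 1).factorial * ∫ x, η x := by
          rw [ih, Nat.factorial_succ]
          push_cast
          ring

end IsTestOn

variable {U : Set ℝ}

theorem exists_isTestOn_integral_eq_one (hU : IsOpen U) (hne : U.Nonempty) :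
    ∃ η, IsTestOn U η ∧ ∫ x, η x = 1 := by
  obtain ⟨x, hx⟩ := hne
  obtain ⟨ε, hε, hball⟩ := Metric.nhds_basis_closedBall.mem_iff.1 (hU.mem_nhds hx)
  let f : ContDiffBump x := ⟨ε / 2, ε, half_pos hε, half_lt_self hε⟩
  exact ⟨f.normed volume, ⟨f.contDiff_normed, f.hasCompactSupport_normed,
    (f.tsupport_normed_eq).trans_subset hball⟩, f.integral_normed⟩

variable {E : Type*} [NormedAddCommGroup E] [NormedSpace ℝ E] {ψ : ℝ → E}

theorem exists_integral_iteratedDeriv_smul_eq (hU : IsOpen U) (hUc : U.OrdConnected)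
    (hne : U.Nonempty) (hψ : ContinuousOn ψ U) {k : ℕ}
    (h : ∀ η, IsTestOn U η → ∫ x, iteratedDeriv (k + 1) η x • ψ x = 0) :
    ∃ v : E, ∀ η, IsTestOn U η → ∫ x, iteratedDeriv k η x • ψ x = (∫ x, η x) • v := by
  obtain ⟨η₀, hη₀, hone⟩ := exists_isTestOn_integral_eq_one hU hne
  refine ⟨∫ x, iteratedDeriv k η₀ x • ψ x, fun η hη => ?_⟩
  obtain ⟨θ, hθ, hθ'⟩ := (hη.sub_smul hη₀ (∫ x, η x)).exists_deriv_eq hUc (by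
    simp only [Pi.sub_apply, Pi.smul_apply, smul_eq_mul]
    rw [integral_sub hη.integrable (hη₀.integrable.const_mul _), integral_const_mul, hone,
      mul_one, sub_self])
  have hθ_iter : ∀ x, iteratedDeriv (k + 1) θ x • ψ x =
      iteratedDeriv k η x • ψ x - (∫ x, η x) • iteratedDeriv k η₀ x • ψ x := fun x => by
    have hsmul : ContDiffAt ℝ k ((∫ x, η x) • η₀) x :=
      ((hη₀.contDiff k).const_smul (∫ x, η x)).contDiffAt
    rw [iteratedDeriv_succ', hθ', iteratedDeriv_sub (hη.contDiff k).contDiffAt hsmul,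
      iteratedDeriv_const_smul_field, sub_smul, smul_eq_mul, mul_smul]
  have hzero := h θ hθ
  simp only [hθ_iter] at hzero
  rwa [integral_sub ((hη.iteratedDeriv k).integrable_smul hU hψ)
    (((hη₀.iteratedDeriv k).integrable_smul hU hψ).fun_smul _), integral_smul,
    sub_eq_zero] at hzero

variable [CompleteSpace E]

theorem eqOn_zero_of_integral_smul_eq_zero (hU : IsOpen U) (hψ : ContinuousOn ψ U)
    (h : ∀ η, IsTestOn U η → ∫ x, η x • ψ x = 0) : Set.EqOn ψ (fun _ => 0) U := by
  have hae := hU.ae_eq_zero_of_integral_contDiff_smul_eq_zero (μ := volume)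
    (hψ.locallyIntegrableOn hU.measurableSet) fun η h₁ h₂ h₃ => h η ⟨h₁, h₂, h₃⟩
  exact Measure.eqOn_open_of_ae_eq ((ae_restrict_iff' hU.measurableSet).2 hae) hU hψ
    continuousOn_const

theorem exists_eqOn_sum_pow_smul (hU : IsOpen U) (hUc : U.OrdConnected) {k : ℕ}
    (hψ : ContinuousOn ψ U) (h : ∀ η, IsTestOn U η → ∫ x, iteratedDeriv k η x • ψ x = 0) :
    ∃ c : ℕ → E, Set.EqOn ψ (fun x => ∑ i ∈ Finset.range k, x ^ i • c i) U := by
  rcases U.eq_empty_or_nonempty with rfl | hne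
  · exact ⟨0, Set.eqOn_empty _ _⟩
  induction k generalizing ψ with
  | zero => exact ⟨0, by simpa using eqOn_zero_of_integral_smul_eq_zero hU hψ (by simpa using h)⟩
  | succ k ih =>
    obtain ⟨v, hv⟩ := exists_integral_iteratedDeriv_smul_eq hU hUc hne hψ h
    set d : E := ((-1 : ℝ) ^ k * k.factorial)⁻¹ • v with hd
    have hpow : ContinuousOn (fun x : ℝ => x ^ k • d) U := by fun_prop
    obtain ⟨c, hc⟩ := ih (hψ.sub hpow) fun η hη => by
      have hmoment : ∫ x, iteratedDeriv k η x • x ^ k • d = (∫ x, η x) • v := by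
        simp only [smul_smul]
        rw [integral_smul_const, hη.integral_iteratedDeriv_mul_pow, hd, smul_smul]
        congr 1
        have : (k.factorial : ℝ) ≠ 0 := by positivity
        have : (-1 : ℝ) ^ k ≠ 0 := by simp
        field_simp
      simp only [Pi.sub_apply, smul_sub]
      rw [integral_sub ((hη.iteratedDeriv k).integrable_smul hU hψ)
        ((hη.iteratedDeriv k).integrable_smul hU hpow), hv η hη, hmoment, sub_self]
    refine ⟨Function.update c k d, fun x hx => ?_⟩
    have hx := hc hx
    simp only [Pi.sub_apply, sub_eq_iff_eq_add] at hx
    beta_reduce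
    rw [hx, Finset.sum_range_succ, Function.update_self]
    congr 1
    exact Finset.sum_congr rfl fun i hi => by
      rw [Function.update_of_ne (Finset.mem_range.1 hi).ne]

end TestFunctions

section GreenKernel

/-- The `j`-th right derivative in `x` of the kernel `(x - a)₊² / 2`, the fundamental solution of
`d³/dx³` supported in `[a, ∞)`. -/
noncomputable def greenKernel : ℕ → ℝ → ℝ → ℝ
  | 0, a, x => max (x - a) 0 ^ 2 / 2
  | 1, a, x => max (x - a) 0
  | 2, a, x => if a ≤ x then 1 else 0
  | _ + 3, _, _ => 0

theorem greenKernel_zero_of_le {a x : ℝ} (h : a ≤ x) : greenKernel 0 a x = (x - a) ^ 2 / 2 := by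
  rw [greenKernel, max_eq_left (sub_nonneg.2 h)]

theorem greenKernel_one_of_le {a x : ℝ} (h : a ≤ x) : greenKernel 1 a x = x - a :=
  max_eq_left (sub_nonneg.2 h)

theorem greenKernel_two_of_le {a x : ℝ} (h : a ≤ x) : greenKernel 2 a x = 1 :=
  if_pos h

theorem greenKernel_zero_of_ge {a x : ℝ} (h : x ≤ a) : greenKernel 0 a x = 0 := by
  rw [greenKernel, max_eq_right (sub_nonpos.2 h)]
  norm_num

theorem greenKernel_one_of_ge {a x : ℝ} (h : x ≤ a) : greenKernel 1 a x = 0 :=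
  max_eq_right (sub_nonpos.2 h)

theorem greenKernel_of_lt {a x : ℝ} (h : x < a) (j : ℕ) : greenKernel j a x = 0 :=
  match j with
  | 0 => greenKernel_zero_of_ge h.le
  | 1 => greenKernel_one_of_ge h.le
  | 2 => if_neg h.not_ge
  | _ + 3 => rfl

theorem greenKernel_taylor {a x y : ℝ} (hay : a ≤ y) (hyx : y ≤ x) (j : ℕ) :
    greenKernel j a x = greenKernel j a y + (x - y) * greenKernel (j + 1) a y +
      (x - y) ^ 2 / 2 * greenKernel (j + 2) a y := by
  match j with
  | 0 =>
    rw [greenKernel_zero_of_le (hay.trans hyx), greenKernel_zero_of_le hay,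
      greenKernel_one_of_le hay, greenKernel_two_of_le hay]
    ring
  | 1 =>
    rw [greenKernel_one_of_le (hay.trans hyx), greenKernel_one_of_le hay,
      greenKernel_two_of_le hay, greenKernel]
    ring
  | 2 =>
    rw [greenKernel_two_of_le (hay.trans hyx), greenKernel_two_of_le hay, greenKernel, greenKernel]
    ring
  | j + 3 => simp only [greenKernel, mul_zero, add_zero]

theorem continuous_greenKernel_zero (a : ℝ) : Continuous (greenKernel 0 a) := by
  unfold greenKernel
  fun_prop

theorem hasDerivWithinAt_greenKernel (j : ℕ) (a x : ℝ) :
    HasDerivWithinAt (greenKernel j a) (greenKernel (j + 1) a x) (Set.Ioi x) x := by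
  rcases le_or_gt a x with hax | hxa
  · have htaylor : HasDerivAt (fun y => greenKernel j a x + (y - x) * greenKernel (j + 1) a x +
        (y - x) ^ 2 / 2 * greenKernel (j + 2) a x) (greenKernel (j + 1) a x) x := by
      have hid : HasDerivAt (fun y => y - x) 1 x := (hasDerivAt_id x).sub_const x
      exact (((hid.mul_const (greenKernel (j + 1) a x)).const_add (greenKernel j a x)).add
        (((hid.pow 2).div_const 2).mul_const (greenKernel (j + 2) a x))).congr_deriv (by simp)
    exact htaylor.hasDerivWithinAt.congr (fun y hy => greenKernel_taylor hax (le_of_lt hy) j)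
      (greenKernel_taylor hax le_rfl j)
  · rw [greenKernel_of_lt hxa]
    refine ((hasDerivAt_const x (0 : ℝ)).congr_of_eventuallyEq ?_).hasDerivWithinAt
    filter_upwards [Iio_mem_nhds hxa] with y hy using greenKernel_of_lt hy j

theorem IsTestOn.integral_iteratedDeriv_mul_greenKernel {U : Set ℝ} {η : ℝ → ℝ}
    (hη : IsTestOn U η) (a : ℝ) :
    ∫ x, iteratedDeriv 3 η x * greenKernel 0 a x = -η a := by
  let F : ℝ → ℝ := fun x =>
    iteratedDeriv 2 η x * ((x - a) ^ 2 / 2) - iteratedDeriv 1 η x * (x - a) + iteratedDeriv 0 η x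
  have hderiv : ∀ x, deriv F x = iteratedDeriv 3 η x * ((x - a) ^ 2 / 2) := fun x => by
    have hid : HasDerivAt (fun y => y - a) 1 x := (hasDerivAt_id x).sub_const a
    have hF : HasDerivAt F _ x :=
      (((hη.hasDerivAt_iteratedDeriv 2 x).mul ((hid.pow 2).div_const 2)).sub
        ((hη.hasDerivAt_iteratedDeriv 1 x).mul hid)).add (hη.hasDerivAt_iteratedDeriv 0 x)
    rw [hF.deriv]
    simp only [Pi.pow_apply]
    push_cast
    ring
  have hsmooth : ContDiff ℝ 1 F := by
    have hη₁ := fun k => (hη.iteratedDeriv k).contDiff 1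
    push_cast at hη₁
    exact (((hη₁ 2).mul (by fun_prop)).sub ((hη₁ 1).mul (by fun_prop))).add (hη₁ 0)
  have hcompact : HasCompactSupport F :=
    ((hη.iteratedDeriv 2).compact.mul_right.sub (hη.iteratedDeriv 1).compact.mul_right).add
      (hη.iteratedDeriv 0).compact
  calc ∫ x, iteratedDeriv 3 η x * greenKernel 0 a x
      = ∫ x in Set.Ioi a, deriv F x := by
        rw [← MeasureTheory.integral_indicator measurableSet_Ioi]
        refine MeasureTheory.integral_congr_ae (.of_forall fun x => ?_)
        by_cases hx : a < x
        · simp only [Set.indicator_of_mem (Set.mem_Ioi.2 hx), hderiv, greenKernel_zero_of_le hx.le]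
        · simp only [Set.indicator_of_notMem (mt Set.mem_Ioi.1 hx),
            greenKernel_zero_of_ge (not_lt.1 hx), mul_zero]
    _ = -η a := by
        rw [hcompact.integral_Ioi_deriv_eq hsmooth a]
        simp [F]

end GreenKernel

section Spline

variable {ι : Type*} [Fintype ι] {A B C : ℂ} {d : ι → ℂ} {ξ : ι → ℝ} {φ : ℝ → ℂ}

/-- The `j`-th right derivative on `[0, ∞)` of the quadratic spline with initial data `A`, `B`, `C`
at `0` whose second derivative drops by `d i` at the knot `ξ i`. -/
noncomputable def spline (A B C : ℂ) (d : ι → ℂ) (ξ : ι → ℝ) (j : ℕ) (x : ℝ) : ℂ :=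
  A * greenKernel (j + 2) 0 x + B * greenKernel (j + 1) 0 x + C * greenKernel j 0 x -
    ∑ i, d i * greenKernel j (ξ i) x

theorem spline_zero_of_nonneg {x : ℝ} (hx : 0 ≤ x) :
    spline A B C d ξ 0 x =
      A + B * x + C * ((x : ℂ) ^ 2 / 2) - ∑ i, d i * greenKernel 0 (ξ i) x := by
  simp [spline, greenKernel_zero_of_le hx, greenKernel_one_of_le hx, greenKernel_two_of_le hx]

theorem continuousOn_spline_zero : ContinuousOn (spline A B C d ξ 0) (Set.Ici 0) := by
  have hkernel := fun i => Complex.continuous_ofReal.comp (continuous_greenKernel_zero (ξ i))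
  have hcont : Continuous fun x : ℝ =>
      A + B * x + C * ((x : ℂ) ^ 2 / 2) - ∑ i, d i * greenKernel 0 (ξ i) x := by fun_prop
  exact hcont.continuousOn.congr fun x hx => spline_zero_of_nonneg hx

theorem hasDerivWithinAt_spline (j : ℕ) (x : ℝ) :
    HasDerivWithinAt (spline A B C d ξ j) (spline A B C d ξ (j + 1) x) (Set.Ioi x) x := by
  have hkernel := fun j a => (hasDerivWithinAt_greenKernel j a x).ofReal_comp
  exact ((((hkernel _ 0).const_mul A).add ((hkernel _ 0).const_mul B)).add
    ((hkernel _ 0).const_mul C)).sub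
    (HasDerivWithinAt.fun_sum fun i _ => (hkernel j (ξ i)).const_mul (d i))

theorem spline_apply_zero (hξ : ∀ i, 0 < ξ i) (j : ℕ) :
    spline A B C d ξ j 0 =
      A * greenKernel (j + 2) 0 0 + B * greenKernel (j + 1) 0 0 + C * greenKernel j 0 0 := by
  simp only [spline, greenKernel_of_lt (hξ _), Complex.ofReal_zero, mul_zero,
    Finset.sum_const_zero, sub_zero]

theorem rightDeriv_eqOn {F F' : ℝ → ℂ} (h : Set.EqOn φ F (Set.Ici 0))
    (hF : ∀ x, HasDerivWithinAt F (F' x) (Set.Ioi x) x) :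
    Set.EqOn (rightDeriv φ) F' (Set.Ici 0) := fun x hx =>
  ((hF x).congr (fun _ hy => h (Set.mem_Ici.2 (le_trans hx (le_of_lt hy)))) (h hx)).derivWithin
    (uniqueDiffWithinAt_Ioi x)

theorem IsTestOn.integral_iteratedDeriv_mul_spline {η : ℝ → ℝ} (hη : IsTestOn (Set.Ioi 0) η) :
    ∫ x, ((iteratedDeriv 3 η x : ℝ) : ℂ) * spline 0 0 C d ξ 0 x = ∑ i, d i * (η (ξ i) : ℂ) := by
  have hkernel : ∀ a, ∫ x, ((iteratedDeriv 3 η x : ℝ) : ℂ) * (greenKernel 0 a x : ℂ) =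
      -(η a : ℂ) := fun a => by
    simpa only [← Complex.ofReal_mul, ← Complex.ofReal_neg, integral_complex_ofReal,
      Complex.ofReal_inj] using hη.integral_iteratedDeriv_mul_greenKernel a
  have hint : ∀ (c : ℂ) a, MeasureTheory.Integrable fun x =>
      c * (((iteratedDeriv 3 η x : ℝ) : ℂ) * (greenKernel 0 a x : ℂ)) := fun c a => by
    simpa only [Complex.real_smul, Function.comp_apply] using
      ((hη.iteratedDeriv 3).integrable_smul isOpen_Ioi (Complex.continuous_ofReal.comp
        (continuous_greenKernel_zero a)).continuousOn).const_mul c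
  calc ∫ x, ((iteratedDeriv 3 η x : ℝ) : ℂ) * spline 0 0 C d ξ 0 x
      = ∫ x, (C * (((iteratedDeriv 3 η x : ℝ) : ℂ) * greenKernel 0 0 x) -
          ∑ i, d i * (((iteratedDeriv 3 η x : ℝ) : ℂ) * greenKernel 0 (ξ i) x)) := by
        refine MeasureTheory.integral_congr_ae (.of_forall fun x => ?_)
        simp only [spline, zero_mul, zero_add, mul_sub, Finset.mul_sum, mul_left_comm]
    _ = C * -(η 0 : ℂ) - ∑ i, d i * -(η (ξ i) : ℂ) := by
        rw [MeasureTheory.integral_sub (hint C 0)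
          (MeasureTheory.integrable_finsetSum _ fun i _ => hint (d i) (ξ i)),
          MeasureTheory.integral_finsetSum _ fun i _ => hint (d i) (ξ i)]
        simp only [MeasureTheory.integral_const_mul, hkernel]
    _ = ∑ i, d i * (η (ξ i) : ℂ) := by
        rw [hη.eq_zero (lt_irrefl (0 : ℝ))]
        simp

end Spline

section FundamentalSolution

open Polynomial

/-- The value at `x` of the `j`-th right derivative of the solution of the initial value problem
with the point masses `m i` at `ξ i`, as a polynomial in the spectral parameter. The masses are
attached from left to right. -/
noncomputable def solPoly : {n : ℕ} → (m ξ : Fin n → ℝ) → ℕ → ℝ → ℝ[X]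
  | 0, _, _, j, x => C (greenKernel j 0 x)
  | n + 1, m, ξ, j, x => solPoly (Fin.init m) (Fin.init ξ) j x -
      X * (C (m (Fin.last n) * greenKernel j (ξ (Fin.last n)) x) *
        solPoly (Fin.init m) (Fin.init ξ) 0 (ξ (Fin.last n)))

/-- The `j`-th right derivative of the solution of the initial value problem with spectral
parameter `z`. -/
noncomputable def fundSol {n : ℕ} (m ξ : Fin n → ℝ) (j : ℕ) (z : ℂ) (x : ℝ) : ℂ :=
  aeval z (solPoly m ξ j x)

variable {n : ℕ}

theorem solPoly_add_three (m ξ : Fin n → ℝ) (j : ℕ) (x : ℝ) : solPoly m ξ (j + 3) x = 0 := by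
  induction n with
  | zero => simp only [solPoly, greenKernel, C_0]
  | succ n ih => simp only [solPoly, ih, greenKernel, mul_zero, C_0, zero_mul, sub_zero]

theorem solPoly_of_lt_last (m : Fin (n + 1) → ℝ) {ξ : Fin (n + 1) → ℝ} {x : ℝ}
    (h : x < ξ (Fin.last n)) (j : ℕ) :
    solPoly m ξ j x = solPoly (Fin.init m) (Fin.init ξ) j x := by
  simp only [solPoly, greenKernel_of_lt h, mul_zero, C_0, zero_mul, sub_zero]

theorem solPoly_zero_last (m ξ : Fin (n + 1) → ℝ) :
    solPoly m ξ 0 (ξ (Fin.last n)) = solPoly (Fin.init m) (Fin.init ξ) 0 (ξ (Fin.last n)) := by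
  simp only [solPoly, greenKernel_zero_of_ge le_rfl, mul_zero, C_0, zero_mul, sub_zero]

theorem solPoly_one_last (m ξ : Fin (n + 1) → ℝ) :
    solPoly m ξ 1 (ξ (Fin.last n)) = solPoly (Fin.init m) (Fin.init ξ) 1 (ξ (Fin.last n)) := by
  simp only [solPoly, greenKernel_one_of_ge le_rfl, mul_zero, C_0, zero_mul, sub_zero]

theorem solPoly_two_last (m ξ : Fin (n + 1) → ℝ) :
    solPoly m ξ 2 (ξ (Fin.last n)) = solPoly (Fin.init m) (Fin.init ξ) 2 (ξ (Fin.last n)) -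
      X * (C (m (Fin.last n)) * solPoly (Fin.init m) (Fin.init ξ) 0 (ξ (Fin.last n))) := by
  simp only [solPoly, greenKernel_two_of_le le_rfl, mul_one]

theorem solPoly_taylor (m : Fin n → ℝ) {ξ : Fin n → ℝ} {x y : ℝ} (hy : 0 ≤ y)
    (hξ : ∀ i, ξ i ≤ y) (hyx : y ≤ x) (j : ℕ) :
    solPoly m ξ j x = solPoly m ξ j y + C (x - y) * solPoly m ξ (j + 1) y +
      C ((x - y) ^ 2 / 2) * solPoly m ξ (j + 2) y := by
  induction n with
  | zero => simp only [solPoly, greenKernel_taylor hy hyx, C_add, C_mul]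
  | succ n ih =>
    simp only [solPoly, greenKernel_taylor (hξ (Fin.last n)) hyx,
      ih (Fin.init m) (ξ := Fin.init ξ) fun i => hξ i.castSucc, C_add, C_mul]
    ring

theorem interlaced_solPoly_last {m ξ : Fin (n + 1) → ℝ} {a b c : ℕ → ℝ} (hm : 0 < m (Fin.last n))
    (h : Interlaced (solPoly (Fin.init m) (Fin.init ξ) 0 (ξ (Fin.last n)))
      (solPoly (Fin.init m) (Fin.init ξ) 1 (ξ (Fin.last n)))
      (solPoly (Fin.init m) (Fin.init ξ) 2 (ξ (Fin.last n))) a b c n n) :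
    ∃ a', Interlaced (solPoly m ξ 0 (ξ (Fin.last n))) (solPoly m ξ 1 (ξ (Fin.last n)))
      (solPoly m ξ 2 (ξ (Fin.last n))) a' b c n (n + 1) := by
  simpa only [solPoly_zero_last, solPoly_one_last, solPoly_two_last] using h.mass hm

theorem exists_interlaced_solPoly {m ξ : Fin n → ℝ} (hm : ∀ i, 0 < m i) (hξ₀ : ∀ i, 0 < ξ i)
    (hξ : StrictMono ξ) {x : ℝ} (hx : 0 < x) (hξx : ∀ i, ξ i < x) :
    ∃ a b c, Interlaced (solPoly m ξ 0 x) (solPoly m ξ 1 x) (solPoly m ξ 2 x) a b c n n := by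
  induction n generalizing x with
  | zero =>
    have hroots : ∀ j, 0 < greenKernel j 0 x → HasRoots (solPoly m ξ j x) 0 0 := fun j hj =>
      ⟨_, hj, by simp [solPoly]⟩
    refine ⟨0, 0, 0, hroots 0 ?_, hroots 1 ?_, hroots 2 ?_, le_rfl, by omega, ?_, ?_, ?_, ?_⟩
    · rw [greenKernel_zero_of_le hx.le]; positivity
    · rwa [greenKernel_one_of_le hx.le, sub_zero]
    · rw [greenKernel_two_of_le hx.le]; exact one_pos
    all_goals intros; omega
  | succ n ih =>
    obtain ⟨a, b, c, h⟩ := ih (m := Fin.init m) (ξ := Fin.init ξ) (fun i => hm _) (fun i => hξ₀ _)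
      (hξ.comp Fin.strictMono_castSucc) (hξ₀ (Fin.last n))
      fun i => hξ (Fin.castSucc_lt_last i)
    obtain ⟨a', h'⟩ := interlaced_solPoly_last (hm _) h
    obtain ⟨b', c', h''⟩ := h'.massless (sub_pos.2 (hξx (Fin.last n)))
    refine ⟨a', b', c', ?_⟩
    have htaylor := solPoly_taylor m (ξ := ξ) (hξ₀ (Fin.last n)).le
      (fun i => hξ.monotone (Fin.le_last i)) (hξx (Fin.last n)).le
    have hthree : solPoly m ξ 3 (ξ (Fin.last n)) = 0 := solPoly_add_three m ξ 0 _
    have hfour : solPoly m ξ 4 (ξ (Fin.last n)) = 0 := solPoly_add_three m ξ 1 _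
    rw [htaylor 0, htaylor 1, htaylor 2]
    simpa only [zero_add, Nat.reduceAdd, hthree, hfour, mul_zero, add_zero] using h''

theorem exists_interlaced_solPoly_last {m ξ : Fin (n + 1) → ℝ} (hm : ∀ i, 0 < m i)
    (hξ₀ : ∀ i, 0 < ξ i) (hξ : StrictMono ξ) :
    ∃ a b c, Interlaced (solPoly m ξ 0 (ξ (Fin.last n))) (solPoly m ξ 1 (ξ (Fin.last n)))
      (solPoly m ξ 2 (ξ (Fin.last n))) a b c n (n + 1) := by
  obtain ⟨a, b, c, h⟩ := exists_interlaced_solPoly (m := Fin.init m) (ξ := Fin.init ξ)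
    (fun i => hm _) (fun i => hξ₀ _) (hξ.comp Fin.strictMono_castSucc) (hξ₀ (Fin.last n))
    fun i => hξ (Fin.castSucc_lt_last i)
  obtain ⟨a', h'⟩ := interlaced_solPoly_last (hm _) h
  exact ⟨a', b, c, h'⟩

theorem fundSol_castSucc (m : Fin (n + 1) → ℝ) {ξ : Fin (n + 1) → ℝ} (hξ : StrictMono ξ) (z : ℂ)
    (i : Fin n) : fundSol m ξ 0 z (ξ i.castSucc) =
      fundSol (Fin.init m) (Fin.init ξ) 0 z (Fin.init ξ i) := by
  rw [fundSol, solPoly_of_lt_last m (hξ (Fin.castSucc_lt_last i)), fundSol, Fin.init]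

theorem fundSol_eq_spline (m : Fin n → ℝ) {ξ : Fin n → ℝ} (hξ : StrictMono ξ) (j : ℕ) (z : ℂ) :
    fundSol m ξ j z = spline 0 0 1 (fun i => z * (m i * fundSol m ξ 0 z (ξ i))) ξ j := by
  ext x
  simp only [spline, zero_mul, one_mul, zero_add]
  induction n with
  | zero => simp [fundSol, solPoly]
  | succ n ih =>
    have hlast : fundSol m ξ 0 z (ξ (Fin.last n)) =
        fundSol (Fin.init m) (Fin.init ξ) 0 z (ξ (Fin.last n)) := by
      rw [fundSol, solPoly_zero_last, fundSol]
    have hsucc : fundSol m ξ j z x = fundSol (Fin.init m) (Fin.init ξ) j z x -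
        z * (m (Fin.last n) * fundSol (Fin.init m) (Fin.init ξ) 0 z (ξ (Fin.last n))) *
          greenKernel j (ξ (Fin.last n)) x := by
      simp only [fundSol, solPoly, map_sub, map_mul, aeval_X, aeval_C, Complex.coe_algebraMap]
      ring
    rw [hsucc, ih _ (ξ := Fin.init ξ) (hξ.comp Fin.strictMono_castSucc), Fin.sum_univ_castSucc,
      hlast, sub_sub]
    simp only [fundSol_castSucc m hξ]
    simp only [Fin.init]

theorem fundSol_add_three (m ξ : Fin n → ℝ) (j : ℕ) (z : ℂ) (x : ℝ) :
    fundSol m ξ (j + 3) z x = 0 := by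
  rw [fundSol, solPoly_add_three, map_zero]

theorem fundSol_taylor (m : Fin n → ℝ) {ξ : Fin n → ℝ} {x y : ℝ} (hy : 0 ≤ y)
    (hξ : ∀ i, ξ i ≤ y) (hyx : y ≤ x) (j : ℕ) (z : ℂ) :
    fundSol m ξ j z x = fundSol m ξ j z y + (x - y) * fundSol m ξ (j + 1) z y +
      (x - y) ^ 2 / 2 * fundSol m ξ (j + 2) z y := by
  simp [fundSol, solPoly_taylor m hy hξ hyx j]

/-- The Lagrange bracket `u'v' - u v'' - u''v` of two solutions with parameters `z` and `w`. -/
noncomputable def lagrangeBracket (m ξ : Fin n → ℝ) (z w : ℂ) (x : ℝ) : ℂ :=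
  fundSol m ξ 1 z x * fundSol m ξ 1 w x - fundSol m ξ 0 z x * fundSol m ξ 2 w x -
    fundSol m ξ 2 z x * fundSol m ξ 0 w x

theorem lagrangeBracket_eq_of_le (m : Fin n → ℝ) {ξ : Fin n → ℝ} {x y : ℝ} (hy : 0 ≤ y)
    (hξ : ∀ i, ξ i ≤ y) (hyx : y ≤ x) (z w : ℂ) :
    lagrangeBracket m ξ z w x = lagrangeBracket m ξ z w y := by
  have hthree : ∀ z, fundSol m ξ 3 z y = 0 := fun z => fundSol_add_three m ξ 0 z y
  have hfour : ∀ z, fundSol m ξ 4 z y = 0 := fun z => fundSol_add_three m ξ 1 z y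
  simp only [lagrangeBracket, fundSol_taylor m hy hξ hyx, zero_add, Nat.reduceAdd, hthree, hfour]
  ring

theorem sum_mul_fundSol_mul_fundSol (m : Fin n → ℝ) {ξ : Fin n → ℝ} (hξ₀ : ∀ i, 0 ≤ ξ i)
    (hξ : StrictMono ξ) (z w : ℂ) {x : ℝ} (hx : 0 ≤ x) (hξx : ∀ i, ξ i ≤ x) :
    (z + w) * ∑ i, m i * (fundSol m ξ 0 z (ξ i) * fundSol m ξ 0 w (ξ i)) =
      lagrangeBracket m ξ z w x := by
  induction n generalizing x with
  | zero =>
    simp only [lagrangeBracket, fundSol, solPoly, greenKernel_zero_of_le hx,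
      greenKernel_one_of_le hx, greenKernel_two_of_le hx, aeval_C, Complex.coe_algebraMap,
      Finset.univ_eq_empty, Finset.sum_empty, sub_zero]
    push_cast
    ring
  | succ n ih =>
    have hξlast : ∀ i, ξ i ≤ ξ (Fin.last n) := fun i => hξ.monotone (Fin.le_last i)
    have ih := ih (Fin.init m) (ξ := Fin.init ξ) (fun i => hξ₀ _)
      (hξ.comp Fin.strictMono_castSucc) (hξ₀ (Fin.last n)) fun i => hξlast _
    rw [lagrangeBracket_eq_of_le m (hξ₀ _) hξlast (hξx _), Fin.sum_univ_castSucc, mul_add]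
    simp only [fundSol_castSucc m hξ]
    refine (congrArg (· + _) ih).trans ?_
    simp only [lagrangeBracket, fundSol, solPoly_zero_last, solPoly_one_last,
      solPoly_two_last, map_sub, map_mul, aeval_X, aeval_C, Complex.coe_algebraMap]
    ring

end FundamentalSolution

section WeakSolutions

open MeasureTheory

variable {n : ℕ} {m ξ : Fin n → ℝ} {z C : ℂ} {φ : ℝ → ℂ}

theorem integrable_massMeasure {E : Type*} [NormedAddCommGroup E] (m ξ : Fin n → ℝ) (F : ℝ → E) :
    Integrable F (massMeasure m ξ) :=
  integrable_finsetSum_measure.2 fun i _ =>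
    (integrable_dirac (by simp)).smul_measure ENNReal.ofReal_ne_top

theorem integral_massMeasure (hm : ∀ i, 0 ≤ m i) (ξ : Fin n → ℝ) (F : ℝ → ℂ) :
    ∫ x, F x ∂(massMeasure m ξ) = ∑ i, (m i : ℂ) * F (ξ i) := by
  rw [massMeasure, integral_finsetSum_measure fun i _ =>
    (integrable_dirac (by simp)).smul_measure ENNReal.ofReal_ne_top]
  refine Finset.sum_congr rfl fun i _ => ?_
  rw [integral_smul_measure, integral_dirac, ENNReal.toReal_ofReal (hm i), Complex.real_smul]

theorem integral_mul_massMeasure (hm : ∀ i, 0 ≤ m i) (ξ : Fin n → ℝ) (z : ℂ) (η : ℝ → ℝ)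
    (φ : ℝ → ℂ) : z * ∫ x, (η x : ℂ) * φ x ∂(massMeasure m ξ) =
      ∑ i, z * (m i * φ (ξ i)) * (η (ξ i) : ℂ) := by
  rw [integral_massMeasure hm, Finset.mul_sum]
  exact Finset.sum_congr rfl fun i _ => by ring

theorem isSolution_of_eqOn_spline (hm : ∀ i, 0 ≤ m i)
    (h : Set.EqOn φ (spline 0 0 C (fun i => z * (m i * φ (ξ i))) ξ 0) (Set.Ici 0)) :
    IsSolution (massMeasure m ξ) z φ := by
  refine ⟨continuousOn_spline_zero.congr h, fun η hsmooth hcompact hsupp => ?_⟩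
  have hη : IsTestOn (Set.Ioi 0) η := ⟨hsmooth, hcompact, hsupp⟩
  rw [integral_mul_massMeasure hm, ← hη.integral_iteratedDeriv_mul_spline (C := C)]
  refine integral_congr_ae (.of_forall fun x => ?_)
  rcases le_or_gt x 0 with hx | hx
  · simp only [(hη.iteratedDeriv 3).eq_zero hx.not_gt, Complex.ofReal_zero, zero_mul]
  · simp only [h hx.le]

namespace IsSolution

theorem exists_eqOn_spline (hm : ∀ i, 0 ≤ m i) (h : IsSolution (massMeasure m ξ) z φ) :
    ∃ A B C, Set.EqOn φ (spline A B C (fun i => z * (m i * φ (ξ i))) ξ 0) (Set.Ici 0) := by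
  set d : Fin n → ℂ := fun i => z * (m i * φ (ξ i))
  have hφ : ContinuousOn φ (Set.Ioi 0) := h.continuousOn.mono Set.Ioi_subset_Ici_self
  have hS : ContinuousOn (spline 0 0 0 d ξ 0) (Set.Ioi 0) :=
    continuousOn_spline_zero.mono Set.Ioi_subset_Ici_self
  obtain ⟨c, hc⟩ := exists_eqOn_sum_pow_smul isOpen_Ioi Set.ordConnected_Ioi (k := 3)
    (hφ.sub hS) fun η hη => by
      have hη₃ := hη.iteratedDeriv 3
      simp only [Pi.sub_apply, smul_sub]
      rw [integral_sub (hη₃.integrable_smul isOpen_Ioi hφ) (hη₃.integrable_smul isOpen_Ioi hS)]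
      simp only [Complex.real_smul]
      rw [h.weak_eq η hη.smooth hη.compact hη.tsupport_subset, integral_mul_massMeasure hm,
        hη.integral_iteratedDeriv_mul_spline, sub_self]
  have heq : Set.EqOn φ (spline (c 0) (c 1) (2 * c 2) d ξ 0) (Set.Ioi 0) := fun x hx => by
    have hcx := hc hx
    simp only [Pi.sub_apply, spline_zero_of_nonneg (le_of_lt hx), Finset.sum_range_succ,
      Finset.sum_range_zero, Complex.real_smul, Complex.ofReal_pow] at hcx ⊢
    linear_combination hcx
  exact ⟨_, _, _, heq.of_subset_closure h.continuousOn continuousOn_spline_zero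
    Set.Ioi_subset_Ici_self (closure_Ioi (0 : ℝ)).ge⟩

theorem eqOn_spline (hm : ∀ i, 0 ≤ m i) (hξ₀ : ∀ i, 0 < ξ i)
    (h : IsSolution (massMeasure m ξ) z φ) (h₀ : φ 0 = 0) (h₁ : rightDeriv φ 0 = 0) :
    Set.EqOn φ (spline 0 0 (rightDeriv (rightDeriv φ) 0) (fun i => z * (m i * φ (ξ i))) ξ 0)
      (Set.Ici 0) := by
  obtain ⟨A, B, C, hφ⟩ := h.exists_eqOn_spline hm
  have hφ' := rightDeriv_eqOn hφ (hasDerivWithinAt_spline 0)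
  have hφ'' := rightDeriv_eqOn hφ' (hasDerivWithinAt_spline 1)
  have hA : A = 0 := by
    simpa [spline_apply_zero hξ₀, greenKernel] using (hφ Set.self_mem_Ici).symm.trans h₀
  have hB : B = 0 := by
    simpa [spline_apply_zero hξ₀, greenKernel] using (hφ' Set.self_mem_Ici).symm.trans h₁
  have hC : rightDeriv (rightDeriv φ) 0 = C := by
    simpa [spline_apply_zero hξ₀, greenKernel] using hφ'' Set.self_mem_Ici
  subst hA hB
  rwa [hC]

end IsSolution

theorem eqOn_mul_fundSol (hξ₀ : ∀ i, 0 ≤ ξ i) (hξ : StrictMono ξ)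
    (h : Set.EqOn φ (spline 0 0 C (fun i => z * (m i * φ (ξ i))) ξ 0) (Set.Ici 0)) :
    Set.EqOn φ (fun x => C * fundSol m ξ 0 z x) (Set.Ici 0) := by
  have hstep : ∀ x, 0 ≤ x → (∀ i, ξ i < x → φ (ξ i) = C * fundSol m ξ 0 z (ξ i)) →
      φ x = C * fundSol m ξ 0 z x := fun x hx hlt => by
    have hterm : ∀ i, z * (m i * φ (ξ i)) * (greenKernel 0 (ξ i) x : ℂ) =
        C * (z * (m i * fundSol m ξ 0 z (ξ i)) * greenKernel 0 (ξ i) x) := fun i => by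
      rcases lt_or_ge (ξ i) x with hix | hix
      · rw [hlt i hix]
        ring
      · rw [greenKernel_zero_of_ge hix, Complex.ofReal_zero, mul_zero, mul_zero, mul_zero]
    rw [h hx, fundSol_eq_spline m hξ]
    simp only [spline, hterm, ← Finset.mul_sum]
    ring
  have hnode : ∀ k, φ (ξ k) = C * fundSol m ξ 0 z (ξ k) := fun k => by
    induction k using WellFoundedLT.induction with
    | _ k ih => exact hstep _ (hξ₀ k) fun i hi => ih i (hξ.lt_iff_lt.1 hi)
  exact fun x hx => hstep x hx fun i _ => hnode i

theorem IsSolution.eqOn_mul_fundSol (hm : ∀ i, 0 ≤ m i) (hξ₀ : ∀ i, 0 < ξ i) (hξ : StrictMono ξ)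
    (h : IsSolution (massMeasure m ξ) z φ) (h₀ : φ 0 = 0) (h₁ : rightDeriv φ 0 = 0) :
    Set.EqOn φ (fun x => rightDeriv (rightDeriv φ) 0 * fundSol m ξ 0 z x) (Set.Ici 0) :=
  CubicString.eqOn_mul_fundSol (fun i => (hξ₀ i).le) hξ (h.eqOn_spline hm hξ₀ h₀ h₁)

theorem hasDerivWithinAt_fundSol (m : Fin n → ℝ) (hξ : StrictMono ξ) (j : ℕ) (z : ℂ) (x : ℝ) :
    HasDerivWithinAt (fundSol m ξ j z) (fundSol m ξ (j + 1) z x) (Set.Ioi x) x := by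
  rw [fundSol_eq_spline m hξ j, fundSol_eq_spline m hξ (j + 1)]
  exact hasDerivWithinAt_spline j x

theorem isIVPSolution_fundSol (hm : ∀ i, 0 ≤ m i) (hξ₀ : ∀ i, 0 < ξ i) (hξ : StrictMono ξ)
    (z : ℂ) : IsIVPSolution (massMeasure m ξ) z (fundSol m ξ 0 z) := by
  have hderiv := rightDeriv_eqOn (Set.eqOn_refl _ _) (hasDerivWithinAt_fundSol m hξ 0 z)
  have hderiv₂ := rightDeriv_eqOn hderiv (hasDerivWithinAt_fundSol m hξ 1 z)
  have hinitial : ∀ j, fundSol m ξ j z 0 = greenKernel j 0 0 := fun j => by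
    rw [fundSol_eq_spline m hξ, spline_apply_zero hξ₀, zero_mul, zero_mul, one_mul, zero_add,
      zero_add]
  refine ⟨isSolution_of_eqOn_spline hm fun x _ => congrFun (fundSol_eq_spline m hξ 0 z) x,
    ?_, ?_, ?_⟩
  · rw [hinitial, greenKernel_zero_of_ge le_rfl, Complex.ofReal_zero]
  · rw [hderiv Set.self_mem_Ici, hinitial, greenKernel_one_of_ge le_rfl, Complex.ofReal_zero]
  · rw [hderiv₂ Set.self_mem_Ici, hinitial, greenKernel_two_of_le le_rfl, Complex.ofReal_one]

theorem IsIVPSolution.eqOn_fundSol (hm : ∀ i, 0 ≤ m i) (hξ₀ : ∀ i, 0 < ξ i) (hξ : StrictMono ξ)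
    (h : IsIVPSolution (massMeasure m ξ) z φ) : Set.EqOn φ (fundSol m ξ 0 z) (Set.Ici 0) := by
  simpa only [h.deriv2_zero, one_mul] using
    h.toIsSolution.eqOn_mul_fundSol hm hξ₀ hξ h.zero h.deriv_zero

theorem endValue_of_eqOn_mul_fundSol (hξ : StrictMono ξ)
    (h : Set.EqOn φ (fun x => C * fundSol m ξ 0 z x) (Set.Ici 0)) (a : Fin 3) :
    endValue a φ = C * fundSol m ξ a z 1 := by
  have hone : (1 : ℝ) ∈ Set.Ici 0 := Set.mem_Ici.2 zero_le_one
  have hderiv := rightDeriv_eqOn h fun x => (hasDerivWithinAt_fundSol m hξ 0 z x).const_mul C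
  have hderiv₂ :=
    rightDeriv_eqOn hderiv fun x => (hasDerivWithinAt_fundSol m hξ 1 z x).const_mul C
  fin_cases a
  exacts [h hone, hderiv hone, hderiv₂ hone]

theorem endValue_fundSol (m : Fin n → ℝ) (hξ : StrictMono ξ) (a : Fin 3) (z : ℂ) :
    endValue a (fundSol m ξ 0 z) = fundSol m ξ a z 1 := by
  rw [endValue_of_eqOn_mul_fundSol hξ (C := 1) fun x _ => (one_mul _).symm, one_mul]

end WeakSolutions

section Spectrum

variable {n : ℕ} {m ξ : Fin n → ℝ} {z : ℂ} {φ : ℝ → ℂ} {a : Fin 3}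

theorem IsEigenfunction.exists_eqOn (hm : ∀ i, 0 ≤ m i) (hξ₀ : ∀ i, 0 < ξ i) (hξ : StrictMono ξ)
    (h : IsEigenfunction (massMeasure m ξ) a z φ) :
    ∃ C ≠ 0, Set.EqOn φ (fun x => C * fundSol m ξ 0 z x) (Set.Ici 0) := by
  have heq := h.toIsSolution.eqOn_mul_fundSol hm hξ₀ hξ h.zero h.deriv_zero
  refine ⟨_, fun hC => ?_, heq⟩
  obtain ⟨x, hx, hne⟩ := h.ne_zero
  exact hne (by simpa only [hC, zero_mul] using heq hx.1)

theorem IsEigenfunction.exists_eqOn_mul (hm : ∀ i, 0 ≤ m i) (hξ₀ : ∀ i, 0 < ξ i)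
    (hξ : StrictMono ξ) {ψ : ℝ → ℂ} (hφ : IsEigenfunction (massMeasure m ξ) a z φ)
    (hψ : IsEigenfunction (massMeasure m ξ) a z ψ) :
    ∃ c : ℂ, Set.EqOn ψ (fun x => c * φ x) (Set.Icc 0 1) := by
  obtain ⟨C, hC, hφC⟩ := hφ.exists_eqOn hm hξ₀ hξ
  obtain ⟨D, -, hψD⟩ := hψ.exists_eqOn hm hξ₀ hξ
  refine ⟨D / C, fun x hx => ?_⟩
  simp only [hφC hx.1, hψD hx.1]
  field_simp

theorem fundSol_zero_of_le (m : Fin n → ℝ) (hξ : StrictMono ξ) {x : ℝ} (hx : 0 ≤ x)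
    (hle : ∀ i, x ≤ ξ i) : fundSol m ξ 0 z x = (x : ℂ) ^ 2 / 2 := by
  rw [fundSol_eq_spline m hξ, spline_zero_of_nonneg hx]
  simp [greenKernel_zero_of_ge (hle _)]

theorem fundSol_first_ne_zero {m ξ : Fin (n + 1) → ℝ} (hξ₀ : 0 < ξ 0) (hξ : StrictMono ξ) :
    fundSol m ξ 0 z (ξ 0) ≠ 0 := by
  rw [fundSol_zero_of_le m hξ hξ₀.le fun i => hξ.monotone (Fin.zero_le i)]
  exact div_ne_zero (pow_ne_zero 2 (Complex.ofReal_ne_zero.2 hξ₀.ne')) two_ne_zero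

theorem eigenvalues_eq {m ξ : Fin (n + 1) → ℝ} (hm : ∀ i, 0 ≤ m i) (hξ₀ : ∀ i, 0 < ξ i)
    (hξ : StrictMono ξ) (hξ₁ : ξ 0 ≤ 1) (a : Fin 3) :
    eigenvalues (massMeasure m ξ) a = {z | endValue a (fundSol m ξ 0 z) = 0} := by
  ext z
  refine ⟨fun ⟨φ, hφ⟩ => ?_, fun hz => ?_⟩
  · obtain ⟨C, hC, heq⟩ := hφ.exists_eqOn hm hξ₀ hξ
    have hend := hφ.endValue_eq
    rw [endValue_of_eqOn_mul_fundSol hξ heq] at hend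
    exact (endValue_fundSol m hξ a z).trans ((mul_eq_zero.1 hend).resolve_left hC)
  · have hivp := isIVPSolution_fundSol hm hξ₀ hξ z
    exact ⟨_, hivp.toIsSolution, hivp.zero, hivp.deriv_zero, hz, ξ 0, ⟨(hξ₀ 0).le, hξ₁⟩,
      fundSol_first_ne_zero (hξ₀ 0) hξ⟩

end Spectrum

section SimpleSpectrum

variable {n N : ℕ} {m ξ : Fin (n + 1) → ℝ} {s : ℕ → ℝ} {a : Fin 3}

theorem eigenvalues_eq_range (hm : ∀ i, 0 ≤ m i) (hξ₀ : ∀ i, 0 < ξ i) (hξ : StrictMono ξ)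
    (hξ₁ : ξ 0 ≤ 1) (h : HasRoots (solPoly m ξ a 1) s N) :
    eigenvalues (massMeasure m ξ) a = Set.range fun j : Fin N => (s j : ℂ) := by
  ext z
  rw [eigenvalues_eq hm hξ₀ hξ hξ₁, Set.mem_ofPred_eq, endValue_fundSol m hξ, fundSol,
    h.aeval_eq_zero_iff, Set.mem_range, Fin.exists_iff]
  simp only [exists_prop, eq_comm]

theorem encard_eigenvalues (hm : ∀ i, 0 ≤ m i) (hξ₀ : ∀ i, 0 < ξ i) (hξ : StrictMono ξ)
    (hξ₁ : ξ 0 ≤ 1) (h : HasRoots (solPoly m ξ a 1) s N) (hs : Set.InjOn s (Set.Iio N)) :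
    (eigenvalues (massMeasure m ξ) a).encard = N := by
  have hinj : Function.Injective fun j : Fin N => (s j : ℂ) := fun i j hij =>
    Fin.ext (hs i.2 j.2 (Complex.ofReal_injective hij))
  rw [eigenvalues_eq_range hm hξ₀ hξ hξ₁ h, ← Set.image_univ, hinj.encard_image,
    Set.encard_univ, ENat.card_eq_coe_fintype_card, Fintype.card_fin]

theorem analyticOrderAt_endValue_fundSol (hξ : StrictMono ξ)
    (h : HasRoots (solPoly m ξ a 1) s N) (hs : Set.InjOn s (Set.Iio N)) {i : ℕ} (hi : i < N) :
    analyticOrderAt (fun z => endValue a (fundSol m ξ 0 z)) (s i) = 1 := by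
  simp only [endValue_fundSol m hξ]
  exact h.analyticOrderAt_aeval (by rwa [Finset.coe_range]) hi

theorem spectrum_of_hasRoots (hm : ∀ i, 0 ≤ m i) (hξ₀ : ∀ i, 0 < ξ i) (hξ : StrictMono ξ)
    (hξ₁ : ξ 0 ≤ 1) (a : Fin 3) (h : HasRoots (solPoly m ξ a 1) s N)
    (hs : Set.InjOn s (Set.Iio N)) (hpos : ∀ i < N, 0 < s i) :
    (eigenvalues (massMeasure m ξ) a = Set.range fun j : Fin N => (s j : ℂ)) ∧
    (eigenvalues (massMeasure m ξ) a).encard = N ∧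
    ∀ w ∈ eigenvalues (massMeasure m ξ) a, w.im = 0 ∧ 0 < w.re ∧
      (∀ φ ψ, IsEigenfunction (massMeasure m ξ) a w φ → IsEigenfunction (massMeasure m ξ) a w ψ →
        ∃ c : ℂ, Set.EqOn ψ (fun x => c * φ x) (Set.Icc 0 1)) ∧
      analyticOrderAt (fun z => endValue a (fundSol m ξ 0 z)) w = 1 := by
  have hrange := eigenvalues_eq_range hm hξ₀ hξ hξ₁ h
  refine ⟨hrange, encard_eigenvalues hm hξ₀ hξ hξ₁ h hs, fun w hw => ?_⟩
  obtain ⟨i, rfl⟩ := hrange ▸ hw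
  exact ⟨Complex.ofReal_im _, hpos i i.2, fun _ _ hφ hψ => hφ.exists_eqOn_mul hm hξ₀ hξ hψ,
    analyticOrderAt_endValue_fundSol hξ h hs i.2⟩

end SimpleSpectrum

section SquareIntegrable

open MeasureTheory

variable {n : ℕ} {m ξ : Fin n → ℝ} {z w : ℂ}

theorem massMeasure_restrict (m : Fin n → ℝ) {s : Set ℝ} (hξ : ∀ i, ξ i ∈ s) :
    (massMeasure m ξ).restrict s = massMeasure m ξ := by
  refine Measure.restrict_eq_self_of_ae_mem (ae_finsetSum_measure_iff.2 fun i _ =>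
    Measure.ae_smul_measure ?_ _)
  rw [ae_dirac_eq]
  exact hξ i

theorem ae_massMeasure_iff (hm : ∀ i, 0 < m i) {p : ℝ → Prop} :
    (∀ᵐ x ∂(massMeasure m ξ), p x) ↔ ∀ i, p (ξ i) := by
  rw [massMeasure, ae_finsetSum_measure_iff]
  refine ⟨fun h i => ?_, fun h i _ => Measure.ae_smul_measure ?_ _⟩
  · have hi := (Measure.ae_ennreal_smul_measure_iff (ENNReal.ofReal_pos.2 (hm i)).ne').1
      (h i (Finset.mem_univ i))
    rwa [ae_dirac_eq] at hi
  · rw [ae_dirac_eq]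
    exact h i

theorem memLp_massMeasure {E : Type*} [NormedAddCommGroup E] (m ξ : Fin n → ℝ) (s : Set ℝ)
    (F : ℝ → E) : MemLp F 2 ((massMeasure m ξ).restrict s) :=
  (memLp_two_iff_integrable_sq_norm
    (integrable_massMeasure m ξ F).aestronglyMeasurable.restrict).2
    (integrable_massMeasure m ξ fun x => ‖F x‖ ^ 2).restrict

theorem linearIndependent_toLp_massMeasure (hm : ∀ i, 0 < m i) {s : Set ℝ}
    (hξ : ∀ i, ξ i ∈ s) {ι : Type*} {f : ι → ℝ → ℂ}
    (h : LinearIndependent ℂ fun j : ι => fun i : Fin n => f j (ξ i)) :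
    LinearIndependent ℂ fun j => (memLp_massMeasure m ξ s (f j)).toLp (f j) := by
  rw [linearIndependent_iff'] at h ⊢
  refine fun t c hc => h t c ?_
  have hae : ∀ᵐ x ∂((massMeasure m ξ).restrict s), ∑ j ∈ t, c j * f j x = 0 := by
    have hcoe :=
      Lp.coeFn_fun_finsetSum t fun j => c j • (memLp_massMeasure m ξ s (f j)).toLp (f j)
    rw [hc] at hcoe
    have hterm : ∀ j ∈ t, ∀ᵐ x ∂((massMeasure m ξ).restrict s),
        (c j • (memLp_massMeasure m ξ s (f j)).toLp (f j)) x = c j * f j x := fun j _ => by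
      filter_upwards [Lp.coeFn_smul (c j) ((memLp_massMeasure m ξ s (f j)).toLp (f j)),
        (memLp_massMeasure m ξ s (f j)).coeFn_toLp] with x hsmul htoLp
      rw [hsmul, Pi.smul_apply, htoLp, smul_eq_mul]
    filter_upwards [hcoe, Lp.coeFn_zero ℂ 2 _, (Finset.eventually_all t).2 hterm]
      with x hsum hzero hx
    rw [← Finset.sum_congr rfl hx, ← hsum, hzero, Pi.zero_apply]
  rw [massMeasure_restrict m hξ] at hae
  ext i
  simpa using (ae_massMeasure_iff hm).1 hae i

theorem form_massMeasure (hm : ∀ i, 0 ≤ m i) (hξ : ∀ i, ξ i ∈ Set.Icc (0 : ℝ) 1)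
    (f h : ℝ → ℂ) : form (massMeasure m ξ) f h = ∑ i, (m i : ℂ) * (f (ξ i) * h (ξ i)) := by
  rw [form, massMeasure_restrict m hξ, integral_massMeasure hm]

theorem form_fundSol (hm : ∀ i, 0 ≤ m i) (hξ : StrictMono ξ) (hξI : ∀ i, ξ i ∈ Set.Icc (0 : ℝ) 1)
    (hzw : z + w ≠ 0) (hz : endValue 2 (fundSol m ξ 0 z) = 0)
    (hw : endValue 2 (fundSol m ξ 0 w) = 0) :
    form (massMeasure m ξ) (fundSol m ξ 0 z) (fundSol m ξ 0 w) =
      rightDeriv (fundSol m ξ 0 z) 1 * rightDeriv (fundSol m ξ 0 w) 1 / (z + w) := by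
  have hlagrange := sum_mul_fundSol_mul_fundSol m (fun i => (hξI i).1) hξ z w zero_le_one
    fun i => (hξI i).2
  have hz₁ : rightDeriv (fundSol m ξ 0 z) 1 = fundSol m ξ 1 z 1 := endValue_fundSol m hξ 1 z
  have hw₁ : rightDeriv (fundSol m ξ 0 w) 1 = fundSol m ξ 1 w 1 := endValue_fundSol m hξ 1 w
  have hz₂ : fundSol m ξ 2 z 1 = 0 := (endValue_fundSol m hξ 2 z).symm.trans hz
  have hw₂ : fundSol m ξ 2 w 1 = 0 := (endValue_fundSol m hξ 2 w).symm.trans hw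
  rw [form_massMeasure hm hξI, eq_div_iff hzw, mul_comm, hlagrange, lagrangeBracket, hz₁, hw₁,
    hz₂, hw₂]
  ring

end SquareIntegrable

section GreenMatrix

/-- The matrix of the integral operator inverting `-φ'''` under the boundary conditions
`φ(0) = φ'(0) = φ''(1) = 0`, acting on the values of `φ` at the point masses. -/
noncomputable def greenMatrix {n : ℕ} (m ξ : Fin n → ℝ) : Matrix (Fin n) (Fin n) ℂ :=
  Matrix.of fun l i => m i * ((ξ l : ℂ) ^ 2 / 2 - greenKernel 0 (ξ i) (ξ l))

variable {n : ℕ}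

theorem greenMatrix_mulVec_fundSol {m ξ : Fin n → ℝ} (hξ₀ : ∀ i, 0 ≤ ξ i) (hξ : StrictMono ξ)
    (hξ₁ : ∀ i, ξ i ≤ 1) {z : ℂ} (hz : endValue 2 (fundSol m ξ 0 z) = 0) :
    z • (greenMatrix m ξ).mulVec (fun i => fundSol m ξ 0 z (ξ i)) =
      fun l => fundSol m ξ 0 z (ξ l) := by
  have htotal : ∑ i, z * (m i * fundSol m ξ 0 z (ξ i)) = 1 := by
    rw [endValue_fundSol m hξ, fundSol_eq_spline m hξ] at hz
    exact (sub_eq_zero.1 (by simpa [spline, greenKernel_two_of_le, hξ₁] using hz)).symm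
  ext l
  conv_rhs => rw [fundSol_eq_spline m hξ, spline_zero_of_nonneg (hξ₀ l)]
  simp only [Pi.smul_apply, Matrix.mulVec, dotProduct, greenMatrix, Matrix.of_apply, smul_eq_mul]
  calc z * ∑ i, m i * ((ξ l : ℂ) ^ 2 / 2 - greenKernel 0 (ξ i) (ξ l)) * fundSol m ξ 0 z (ξ i)
      = (∑ i, z * (m i * fundSol m ξ 0 z (ξ i))) * ((ξ l : ℂ) ^ 2 / 2) -
          ∑ i, z * (m i * fundSol m ξ 0 z (ξ i)) * greenKernel 0 (ξ i) (ξ l) := by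
        rw [Finset.mul_sum, Finset.sum_mul, ← Finset.sum_sub_distrib]
        exact Finset.sum_congr rfl fun i _ => by ring
    _ = _ := by rw [htotal]; ring

theorem linearIndependent_fundSol {m ξ : Fin (n + 1) → ℝ} (hξ₀ : ∀ i, 0 < ξ i)
    (hξ : StrictMono ξ) (hξ₁ : ∀ i, ξ i ≤ 1) {ι : Type*} {z : ι → ℂ} (hz : Function.Injective z)
    (hz₀ : ∀ j, z j ≠ 0) (hend : ∀ j, endValue 2 (fundSol m ξ 0 (z j)) = 0) :
    LinearIndependent ℂ fun j => fun i => fundSol m ξ 0 (z j) (ξ i) := by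
  refine Module.End.eigenvectors_linearIndependent' (Matrix.toLin' (greenMatrix m ξ))
    (fun j => (z j)⁻¹) (inv_injective.comp hz) _ fun j =>
      ⟨Module.End.mem_eigenspace_iff.2 ?_, fun h => fundSol_first_ne_zero (hξ₀ 0) hξ (congrFun h 0)⟩
  rw [Matrix.toLin'_apply, eq_inv_smul_iff₀ (hz₀ j)]
  exact greenMatrix_mulVec_fundSol (fun i => (hξ₀ i).le) hξ hξ₁ (hend j)

end GreenMatrix

end CubicString

theorem mainTheorem5 (n : ℕ) (hn : 1 ≤ n) (m ξ : Fin n → ℝ)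
    (hm : ∀ i, 0 < m i) (hξpos : ∀ i, 0 < ξ i) (hξ : StrictMono ξ)
    (hlast : ξ ⟨n - 1, by omega⟩ = 1) :
    -- the solution `φ z` of the initial value problem exists and is unique on `[0, ∞)`
    ∃ φ : ℂ → ℝ → ℂ,
      (∀ z, CubicString.IsIVPSolution (CubicString.massMeasure m ξ) z (φ z)) ∧
      (∀ z ψ, CubicString.IsIVPSolution (CubicString.massMeasure m ξ) z ψ →
        Set.EqOn ψ (φ z) (Set.Ici 0)) ∧
      -- the spectra are positive and simple (one-dimensional eigenspaces, and simple zeros of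
      -- the characteristic function)
      (∀ a : Fin 3, ∀ w ∈ CubicString.eigenvalues (CubicString.massMeasure m ξ) a,
        w.im = 0 ∧ 0 < w.re ∧
        (∀ ψ χ, CubicString.IsEigenfunction (CubicString.massMeasure m ξ) a w ψ →
          CubicString.IsEigenfunction (CubicString.massMeasure m ξ) a w χ →
          ∃ c : ℂ, Set.EqOn χ (fun x => c * ψ x) (Set.Icc 0 1)) ∧
        analyticOrderAt (fun z => CubicString.endValue a (φ z)) w = 1) ∧
      -- the spectra are the zero sets of the characteristic functions
      (∀ a : Fin 3, CubicString.eigenvalues (CubicString.massMeasure m ξ) a =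
        {z | CubicString.endValue a (φ z) = 0}) ∧
      -- cardinalities
      (CubicString.eigenvalues (CubicString.massMeasure m ξ) 0).encard = (n - 1 : ℕ) ∧
      (CubicString.eigenvalues (CubicString.massMeasure m ξ) 1).encard = (n - 1 : ℕ) ∧
      (CubicString.eigenvalues (CubicString.massMeasure m ξ) 2).encard = n ∧
      -- enumeration and interlacing
      ∃ (z₀ z₁ : Fin (n - 1) → ℝ) (z₂ : Fin n → ℝ),
        CubicString.eigenvalues (CubicString.massMeasure m ξ) 0 =
          Set.range (fun j => (z₀ j : ℂ)) ∧
        CubicString.eigenvalues (CubicString.massMeasure m ξ) 1 =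
          Set.range (fun j => (z₁ j : ℂ)) ∧
        CubicString.eigenvalues (CubicString.massMeasure m ξ) 2 =
          Set.range (fun j => (z₂ j : ℂ)) ∧
        0 < z₂ ⟨0, by omega⟩ ∧
        (∀ j : Fin (n - 1), z₂ ⟨j, by omega⟩ < z₁ j ∧ z₁ j < z₀ j ∧
          z₀ j < z₂ ⟨j + 1, by omega⟩) ∧
        -- factorization for the type 2 eigenfunctions
        (∀ i j : Fin n,
          CubicString.form (CubicString.massMeasure m ξ) (φ (z₂ i)) (φ (z₂ j)) =
            CubicString.rightDeriv (φ (z₂ i)) 1 * CubicString.rightDeriv (φ (z₂ j)) 1 /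
              ((z₂ i : ℂ) + (z₂ j : ℂ))) ∧
        -- linear independence in the space `L²` of `g` on `[0, 1]`
        ∃ hL : ∀ j : Fin n, MeasureTheory.MemLp (φ (z₂ j)) 2
            ((CubicString.massMeasure m ξ).restrict (Set.Icc 0 1)),
          LinearIndependent ℂ (fun j : Fin n => (hL j).toLp (φ (z₂ j))) := by
  open CubicString in
  obtain ⟨k, rfl⟩ : ∃ k, n = k + 1 := ⟨n - 1, by omega⟩
  have hm₀ : ∀ i, 0 ≤ m i := fun i => (hm i).le
  have hξ₁ : ∀ i, ξ i ≤ 1 := fun i => hlast ▸ hξ.monotone (Fin.le_last i)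
  have hξI : ∀ i, ξ i ∈ Set.Icc (0 : ℝ) 1 := fun i => ⟨(hξpos i).le, hξ₁ i⟩
  obtain ⟨a, b, c, H⟩ := hlast ▸ exists_interlaced_solPoly_last hm hξpos hξ
  have hpos : ∀ j : Fin (k + 1), 0 < a j := fun j => H.pos j j.2
  have hinj : Function.Injective fun j : Fin (k + 1) => (a j : ℂ) := fun i j hij =>
    Fin.ext (H.strictMonoOn_curvature.injOn i.2 j.2 (Complex.ofReal_injective hij))
  obtain ⟨hrange₀, hcard₀, hsimple₀⟩ := spectrum_of_hasRoots hm₀ hξpos hξ (hξ₁ 0) 0 H.value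
    H.strictMonoOn_value.injOn fun _ => H.pos_value
  obtain ⟨hrange₁, hcard₁, hsimple₁⟩ := spectrum_of_hasRoots hm₀ hξpos hξ (hξ₁ 0) 1 H.slope
    H.strictMonoOn_slope.injOn fun _ => H.pos_slope
  obtain ⟨hrange₂, hcard₂, hsimple₂⟩ := spectrum_of_hasRoots hm₀ hξpos hξ (hξ₁ 0) 2 H.curvature
    H.strictMonoOn_curvature.injOn H.pos
  have hzeros := eigenvalues_eq hm₀ hξpos hξ (hξ₁ 0)
  have hend : ∀ j : Fin (k + 1), endValue 2 (fundSol m ξ 0 (a j)) = 0 := fun j =>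
    (hzeros 2).symm.trans hrange₂ |>.ge ⟨j, rfl⟩
  refine ⟨fundSol m ξ 0, isIVPSolution_fundSol hm₀ hξpos hξ, fun z ψ hψ =>
    hψ.eqOn_fundSol hm₀ hξpos hξ, fun | 0 => hsimple₀ | 1 => hsimple₁ | 2 => hsimple₂,
    hzeros, hcard₀, hcard₁, hcard₂, fun j => c j, fun j => b j, fun j => a j,
    hrange₀, hrange₁, hrange₂, hpos 0,
    fun j => ⟨H.lt_slope j j.2, H.slope_lt j j.2, H.lt_succ j (by omega)⟩,
    fun i j => form_fundSol hm₀ hξ hξI (mod_cast (add_pos (hpos i) (hpos j)).ne') (hend i) (hend j),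
    _, linearIndependent_toLp_massMeasure hm hξI (linearIndependent_fundSol hξpos hξ hξ₁ hinj
      (fun j => Complex.ofReal_ne_zero.2 (hpos j).ne') hend)⟩
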